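/- Let $\pi\colon\mathbb{R}\to\mathbb{R}/\mathbb{Z}$ be the projection, and let $\lVert x\rVert$ denote the distance from a real number $x$ to the nearest integer. A limit value of a sequence is a limit of one of its convergent subsequences. The length of $P(x)=\sum_{i=0}^d a_ix^i\in\mathbb{R}[x]$ is $L(P)=\sum_{i=0}^d|a_i|$, and its reduced length is $\ell(P)=\inf_Q L(PQ)$, where $Q$ runs through the polynomials in $\mathbb{R}[x]$ with leading coefficient $1$ or constant coefficient $1$. The overreduced length of a nonzero $R\in\mathbb{Z}[x]$ is $\lambda(R)=\min_Q\ell(R/Q)$, where $Q$ runs through the factors of $R$ in $\mathbb{Z}[x]$ such that every complex root of $Q$ is a root of unity or has modulus $<1$, and every root of $Q$ that is a root of unity is simple. For a field automorphism $\sigma$ of $\mathbb{C}$ and $F\in\mathbb{C}[x]$, $\sigma(F)$ is obtained by applying $\sigma$ to the coefficients of $F$. The zero polynomial has degree $-1$. **Theorem 1.3.** Let $R(x)=\sum_{i=0}^r u_ix^i\in\mathbb{Z}[x]$ be a nonzero polynomial and let $(x_k)_{k\ge1}$ be a sequence of real numbers satisfying $\sum_{i=0}^r u_ix_{k+i}=0$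 for all $k\ge1$. Assume that $x_k=\sum_{i=1}^nF_i(k)\alpha_i^k$ for all $k\ge1$, where $\alpha_1,\dots,\alpha_n\in\mathbb{C}$ are pairwise distinct and $F_1,\dots,F_n\in\mathbb{C}[x]$. Assume that at least one of the following conditions holds: (a) there exists $1\le i\le n$ such that $F_i\ne0$, $|\alpha_i|>1$ and $\alpha_i$ is not an algebraic integer; (b) there exists $1\le i\le n$ such that $\deg(F_i)\ge1$, $|\alpha_i|=1$ and $\alpha_i$ is not an algebraic integer; (c) there exist $1\le i,j\le n$ and a field automorphism $\sigma\colon\mathbb{C}\to\mathbb{C}$ such that $|\alpha_i|>1$, $|\alpha_j|>1$, $\sigma(\alpha_i)=\alpha_j$ and $\sigma(F_i)\ne F_j$; (d) there exist $1\le i,j\le n$ and a field automorphism $\sigma\colon\mathbb{C}\to\mathbb{C}$ such that $|\alpha_i|\ge1$, $|\alpha_j|\ge1$, $\sigma(\alpha_i)=\alpha_j$ and $\deg(\sigma(F_i)-F_j)\ge1$. Then the set $E$ of limit values of $(\pi(x_k))_{k\ge1}$ is infinite, $$\limsup_{k\to\infty}\lVert x_k\rVert\ge 1/L(R),$$ and,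 for every integer $M\ge1$, there exists an integer $l\ge0$ such that the set of limit values of $(\pi(x_{kM+l}))_{k\ge1}$ is not contained in any interval of $\mathbb{R}/\mathbb{Z}$ of length $<1/\lambda(R)$. Moreover, the assertion that $E$ is infinite still holds (in place of (a)–(d)) under the following condition: (e) there exist $1\le i,j\le n$ and a field automorphism $\sigma\colon\mathbb{C}\to\mathbb{C}$ such that $|\alpha_i|>1$, $|\alpha_j|\ge1$, $\sigma(\alpha_i)=\alpha_j$ and $\sigma(F_i)\ne F_j$. -/

import Mathlib

open Polynomial Filter

namespace ModOne

/-- The length of a polynomial: the sum of the absolute values of its coefficients. -/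
noncomputable def polyLength (P : ℝ[X]) : ℝ :=
  ∑ i ∈ Finset.range (P.natDegree + 1), |P.coeff i|

/-- The reduced length of a real polynomial: the infimum of the lengths of its multiples by real
polynomials with leading coefficient one or constant coefficient one. -/
noncomputable def reducedLength (P : ℝ[X]) : ℝ :=
  sInf {t : ℝ | ∃ Q : ℝ[X], (Q.leadingCoeff = 1 ∨ Q.coeff 0 = 1) ∧ t = polyLength (P * Q)}

/-- Every complex root of `Q` is a root of unity or has modulus less than one, and every root of
`Q` that is a root of unity is simple. -/
def IsRemovableFactor (Q : ℤ[X]) : Prop :=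
  ∀ z : ℂ, (Q.map (Int.castRingHom ℂ)).IsRoot z →
    ((∃ m : ℕ, 1 ≤ m ∧ z ^ m = 1) ∨ ‖z‖ < 1) ∧
    ((∃ m : ℕ, 1 ≤ m ∧ z ^ m = 1) → (Q.map (Int.castRingHom ℂ)).rootMultiplicity z = 1)

/-- The overreduced length of an integer polynomial: the least reduced length of a quotient
`P = R / Q`, where `Q` runs through the removable factors of `R` in `ℤ[X]`. A nonzero `R` has only
finitely many factors in `ℤ[X]`, and `Q = 1` is removable, so this infimum is then a minimum. -/
noncomputable def overreducedLength (R : ℤ[X]) : ℝ :=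
  sInf {t : ℝ | ∃ P Q : ℤ[X], R = P * Q ∧ IsRemovableFactor Q ∧
    t = reducedLength (P.map (Int.castRingHom ℝ))}

/-- The distance from a real number to the nearest integer. -/
noncomputable def distNearestInt (x : ℝ) : ℝ := |x - round x|

/-- The set of limit values in `ℝ/ℤ` of a real sequence reduced modulo one. -/
def limitValuesModOne (x : ℕ → ℝ) : Set UnitAddCircle :=
  {z | MapClusterPt z atTop fun k : ℕ => (x k : UnitAddCircle)}

/-- The closed interval of `ℝ/ℤ` that is the image of `[a, b]`. An arbitrary interval of `ℝ/ℤ` of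
a given length is contained in one of this form with `b - a` equal to that length. -/
def circleInterval (a b : ℝ) : Set UnitAddCircle :=
  (fun t : ℝ => (t : UnitAddCircle)) '' Set.Icc a b

end ModOne

/-! Argue by contraposition. If a conclusion fails, there are an integer `D ≥ 1` and an integer
sequence `Y`, eventually annihilated by a nonzero integer polynomial in the shift, such that `D x -
Y` is bounded. Such a `Y` is eventually an exponential polynomial. By Fatou's lemma
(`exists_monic_act_eq_zero`) its nonzero exponents are algebraic integers. Since automorphisms of ℂ
fix integers, uniqueness of coefficients makes those of `Y` Galois equivariant
(`exists_expSum_of_int`). A bounded exponential polynomial has no component with exponent of modulus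
> 1, and only constant coefficients at modulus 1. So `D F_i` is the coefficient of `Y` at `α_i`, up
to a constant when `|α_i| = 1`, which contradicts each of (a)–(d) (`not_isWild_of_bounded`).

The construction of `Y` depends on the conclusion. For the limsup bound, round `x`: applying `R` to
the rounding errors gives integers of absolute value < 1 (`exists_recurrent_of_limsup_lt`). For
finitely many limit values, `x` is, up to a null sequence, an integer plus one of finitely many
reals; a ℚ-linear projection ℝ → ℚ fixing 1, followed by clearing denominators, gives `Y`
(`exists_recurrent_of_finite`). Then `D x - Y` is moreover asymptotically periodic, which settles
(e). For intervals, write `R = P Q` with `Q` removable and choose `S` with `L(P S)` small. The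
integer sequence `P(Y)` takes finitely many values, and `S` applied to it oscillates by less than 1
along residue classes, so it is eventually periodic, and `(X ^ N - 1) P` annihilates `Y` eventually
(`exists_recurrent_of_oscillation`). -/

namespace ModOne

/-! ### Polynomials in the shift acting on sequences. -/

section Shift

/-- The shift operator on sequences. -/
def shift (K M : Type*) [CommRing K] [AddCommGroup M] [Module K M] :
    (ℕ → M) →ₗ[K] (ℕ → M) :=
  LinearMap.funLeft K M (· + 1)

variable {K M : Type*} [CommRing K] [AddCommGroup M] [Module K M]

theorem shift_pow_apply (n : ℕ) (g : ℕ → M) (k : ℕ) : (shift K M ^ n) g k = g (k + n) := by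
  induction n generalizing g with
  | zero => simp
  | succ n ih =>
    rw [pow_succ, Module.End.mul_apply, ih]
    simp [shift, LinearMap.funLeft_apply, add_assoc]

/-- The action of a polynomial in the shift operator on sequences. -/
noncomputable def act (A : K[X]) (g : ℕ → M) : ℕ → M := aeval (shift K M) A g

theorem act_apply (A : K[X]) (g : ℕ → M) (k : ℕ) :
    act A g k = ∑ i ∈ A.support, A.coeff i • g (k + i) := by
  rw [act, aeval_endomorphism, Polynomial.sum, Finset.sum_apply]
  exact Finset.sum_congr rfl fun i _ => by rw [Pi.smul_apply, shift_pow_apply]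

theorem act_apply_range (A : K[X]) (g : ℕ → M) (k : ℕ) :
    act A g k = ∑ i ∈ Finset.range (A.natDegree + 1), A.coeff i • g (k + i) := by
  rw [act, aeval_endomorphism, Polynomial.sum_over_range _ (by simp), Finset.sum_apply]
  exact Finset.sum_congr rfl fun i _ => by rw [Pi.smul_apply, shift_pow_apply]

theorem act_mul (A B : K[X]) (g : ℕ → M) : act (A * B) g = act A (act B g) := by
  simp [act, Module.End.mul_apply]

theorem act_mul_comm (A B : K[X]) (g : ℕ → M) : act A (act B g) = act B (act A g) := by
  rw [← act_mul, mul_comm, act_mul]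

theorem act_add_left (A B : K[X]) (g : ℕ → M) : act (A + B) g = act A g + act B g := by
  simp [act]

theorem act_sub_left (A B : K[X]) (g : ℕ → M) : act (A - B) g = act A g - act B g := by
  simp [act]

theorem act_add (A : K[X]) (g h : ℕ → M) : act A (g + h) = act A g + act A h := by
  simp [act]

theorem act_sub (A : K[X]) (g h : ℕ → M) : act A (g - h) = act A g - act A h := by
  simp [act]

theorem act_zero (A : K[X]) : act A (0 : ℕ → M) = 0 := by
  simp [act]

theorem act_one (g : ℕ → M) : act (1 : K[X]) g = g := by
  simp [act]

theorem act_X_pow (n : ℕ) (g : ℕ → M) (k : ℕ) : act (X ^ n : K[X]) g k = g (k + n) := by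
  rw [act, map_pow, aeval_X, shift_pow_apply]

theorem act_X (g : ℕ → M) (k : ℕ) : act (X : K[X]) g k = g (k + 1) := by
  simpa using act_X_pow (K := K) 1 g k

theorem act_C (c : K) (g : ℕ → M) : act (C c : K[X]) g = c • g := by
  simp [act]

theorem act_X_pow_sub_one (n : ℕ) (g : ℕ → M) (k : ℕ) :
    act (X ^ n - 1 : K[X]) g k = g (k + n) - g k := by
  rw [act_sub_left, Pi.sub_apply, act_X_pow, act_one]

theorem act_X_sub_C (c : K) (g : ℕ → M) (k : ℕ) :
    act (X - C c : K[X]) g k = g (k + 1) - c • g k := by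
  rw [act_sub_left, Pi.sub_apply, act_X, act_C, Pi.smul_apply]

theorem act_eventuallyEq (A : K[X]) {f g : ℕ → M} (h : f =ᶠ[atTop] g) :
    act A f =ᶠ[atTop] act A g := by
  obtain ⟨N, hN⟩ := eventually_atTop.1 h
  refine eventually_atTop.2 ⟨N, fun k hk => ?_⟩
  simp only [act_apply]
  exact Finset.sum_congr rfl fun i _ => by rw [hN (k + i) (by omega)]

theorem tendsto_act_zero [TopologicalSpace M] [ContinuousAdd M] [ContinuousConstSMul K M]
    (A : K[X]) {g : ℕ → M} (h : Tendsto g atTop (nhds 0)) :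
    Tendsto (act A g) atTop (nhds 0) := by
  have h1 : act A g = fun k => ∑ i ∈ A.support, A.coeff i • g (k + i) :=
    funext fun k => act_apply A g k
  rw [h1, show (0 : M) = ∑ i ∈ A.support, A.coeff i • (0 : M) by simp]
  exact tendsto_finsetSum _ fun i _ => (h.comp (tendsto_add_atTop_nat i)).const_smul _

/-- Additive maps commute with the action of integer polynomials. -/
theorem act_comp_addMonoidHom {M M' : Type*} [AddCommGroup M] [AddCommGroup M'] (φ : M →+ M')
    (A : ℤ[X]) (g : ℕ → M) (k : ℕ) : act A (fun k => φ (g k)) k = φ (act A g k) := by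
  simp [act_apply, map_sum, map_zsmul]

theorem act_map_intCast {K : Type*} [CommRing K] [CharZero K] (A : ℤ[X]) (g : ℕ → K) :
    act (A.map (Int.castRingHom K)) g = act A g := by
  funext k
  rw [act_apply_range, act_apply_range,
    natDegree_map_eq_of_injective (Int.castRingHom K).injective_int]
  simp

/-- A solution of a recurrence that vanishes on a block of the length of the recurrence vanishes
from there on. -/
theorem eq_zero_of_act_eq_zero [IsDomain K] [Module.IsTorsionFree K M] {A : K[X]} (hA : A ≠ 0)
    {g : ℕ → M} {m : ℕ}
    (hg : ∀ k, m ≤ k → act A g k = 0) (h0 : ∀ i < A.natDegree, g (m + i) = 0) :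
    ∀ k, m ≤ k → g k = 0 := by
  intro k
  induction k using Nat.strong_induction_on with
  | _ k ih =>
    intro hk
    by_cases hlt : k < m + A.natDegree
    · obtain ⟨i, rfl⟩ := Nat.exists_eq_add_of_le hk
      exact h0 i (by omega)
    · obtain ⟨j, rfl⟩ := Nat.exists_eq_add_of_le (not_lt.1 hlt)
      have h1 := hg (m + j) (by omega)
      rw [act_apply_range, Finset.sum_range_succ, Finset.sum_eq_zero, zero_add] at h1
      · rcases smul_eq_zero.1 h1 with h2 | h2
        · exact absurd (leadingCoeff_eq_zero.1 h2) hA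
        · rwa [show m + A.natDegree + j = m + j + A.natDegree by ring]
      · intro i hi
        rw [ih (m + j + i) (by have := Finset.mem_range.1 hi; omega) (by omega), smul_zero]

end Shift

open Asymptotics in
theorem isBigO_act {K : Type*} [NormedField K] (A : K[X]) {g : ℕ → K}
    (h : g =O[atTop] (fun _ => (1 : ℝ))) : act A g =O[atTop] (fun _ => (1 : ℝ)) := by
  have h1 : act A g = ∑ i ∈ A.support, A.coeff i • (g ∘ fun k => k + i) := by
    funext k
    simp [act_apply]
  rw [h1]
  exact IsBigO.sum fun i _ =>
    IsBigO.const_smul_left (h.comp_tendsto (tendsto_add_atTop_nat i)) (A.coeff i)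

/-- Fatou's lemma for integer sequences: an integer solution of a linear recurrence with integer
coefficients satisfies one with leading coefficient one. -/
theorem exists_monic_act_eq_zero {P : ℤ[X]} (hP : P ≠ 0) :
    ∃ A : ℤ[X], A.Monic ∧ ∀ y : ℕ → ℤ, act P y = 0 → act A y = 0 := by
  let N : Submodule ℤ (ℕ → ℤ) := LinearMap.ker (aeval (shift ℤ ℤ) P)
  have hN : ∀ y, y ∈ N ↔ act P y = 0 := fun y => LinearMap.mem_ker
  -- Initial values embed the solution module into a free module of finite rank, so it is finitely
  -- generated over ℤ, even when `P` is not monic.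
  let ρ : N →ₗ[ℤ] (Fin P.natDegree → ℤ) :=
    (LinearMap.funLeft ℤ ℤ (fun i : Fin P.natDegree => (i : ℕ))).comp N.subtype
  have hρ : Function.Injective ρ := by
    rw [injective_iff_map_eq_zero]
    rintro ⟨y, hy⟩ h
    ext k
    refine eq_zero_of_act_eq_zero hP (m := 0) (g := y) (fun k _ => ?_) (fun i hi => ?_) k
      (Nat.zero_le k)
    · rw [(hN y).1 hy]; rfl
    · have := congrFun h ⟨i, hi⟩
      simpa [ρ, LinearMap.funLeft_apply] using this
  have : Module.Finite ℤ N := Module.Finite.of_injective ρ hρ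
  have hT : ∀ y ∈ N, shift ℤ ℤ y ∈ N := by
    intro y hy
    rw [hN] at hy ⊢
    have : shift ℤ ℤ y = act (X : ℤ[X]) y := by simp [act]
    rw [this, act_mul_comm, hy, act_zero]
  -- Cayley–Hamilton: an endomorphism of a finite ℤ-module satisfies a monic integer equation.
  obtain ⟨A, hA, h0⟩ := Algebra.IsIntegral.isIntegral (R := ℤ) ((shift ℤ ℤ).restrict hT)
  refine ⟨A, hA, fun y hy => ?_⟩
  have h1 := congrArg (fun f : Module.End ℤ N => ((f ⟨y, (hN y).2 hy⟩ : N) : ℕ → ℤ)) h0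
  rw [← aeval_def] at h1
  funext k
  have h2 : ∀ n : ℕ, ∀ z : N, ((((shift ℤ ℤ).restrict hT ^ n) z : N) : ℕ → ℤ) =
      (shift ℤ ℤ ^ n) z := by
    intro n
    induction n with
    | zero => simp
    | succ n ih => intro z; rw [pow_succ, pow_succ, Module.End.mul_apply, ih]; rfl
  simp only [aeval_endomorphism, Polynomial.sum] at h1
  have h3 := congrFun h1 k
  simp only [AddSubmonoidClass.coe_finsetSum, SetLike.val_smul, h2, Finset.sum_apply,
    Pi.smul_apply, shift_pow_apply] at h3
  rw [act_apply, h3]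
  rfl


/-! ### Exponential polynomials. -/

/-- The sequence `H(k) α ^ k`. -/
noncomputable def expPoly (α : ℂ) : ℂ[X] →ₗ[ℂ] (ℕ → ℂ) where
  toFun H k := H.eval (k : ℂ) * α ^ k
  map_add' H H' := by funext k; simp [add_mul]
  map_smul' c H := by funext k; simp [mul_assoc]

theorem expPoly_apply (α : ℂ) (H : ℂ[X]) (k : ℕ) : expPoly α H k = H.eval (k : ℂ) * α ^ k := rfl

/-- The operator on polynomials that corresponds to the shift of `H(k) α ^ k`. -/
noncomputable def twist (α : ℂ) : ℂ[X] →ₗ[ℂ] ℂ[X] := α • taylor 1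

theorem twist_apply (α : ℂ) (H : ℂ[X]) : twist α H = α • taylor 1 H := rfl

theorem act_expPoly (A : ℂ[X]) (α : ℂ) (H : ℂ[X]) :
    act A (expPoly α H) = expPoly α (aeval (twist α) A H) := by
  have h1 : ∀ H : ℂ[X], shift ℂ ℂ (expPoly α H) = expPoly α (twist α H) := by
    intro H
    funext k
    simp [shift, LinearMap.funLeft_apply, expPoly_apply, twist_apply, taylor_eval, pow_succ]
    ring
  have h2 : ∀ (n : ℕ) (H : ℂ[X]),
      (shift ℂ ℂ ^ n) (expPoly α H) = expPoly α ((twist α ^ n) H) := by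
    intro n
    induction n with
    | zero => simp
    | succ n ih => intro H; rw [pow_succ, pow_succ, Module.End.mul_apply, h1, ih]; rfl
  rw [act, aeval_endomorphism, aeval_endomorphism, Polynomial.sum, Polynomial.sum, map_sum]
  simp only [h2, map_smul]

theorem natDegree_twist_pow_le (α : ℂ) (n : ℕ) (H : ℂ[X]) {d : ℕ} (hd : H.natDegree ≤ d) :
    ((twist α ^ n) H).natDegree ≤ d ∧ ((twist α ^ n) H).coeff d = α ^ n * H.coeff d := by
  induction n generalizing H with
  | zero => simpa using hd
  | succ n ih =>
    have h1 : (twist α H).natDegree ≤ d :=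
      (natDegree_smul_le _ _).trans (by rwa [natDegree_taylor])
    have h2 : (twist α H).coeff d = α * H.coeff d := by
      rw [twist_apply, coeff_smul, smul_eq_mul]
      congr 1
      rcases hd.lt_or_eq with h | h
      · rw [coeff_eq_zero_of_natDegree_lt (by rwa [natDegree_taylor]),
          coeff_eq_zero_of_natDegree_lt h]
      · rw [← h, coeff_natDegree]
        conv_lhs => rw [← natDegree_taylor H 1, coeff_natDegree]
        exact leadingCoeff_taylor _ _
    obtain ⟨h3, h4⟩ := ih _ h1
    rw [pow_succ, Module.End.mul_apply]
    exact ⟨h3, by rw [h4, h2]; ring⟩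

theorem natDegree_aeval_twist_le (A : ℂ[X]) (α : ℂ) (H : ℂ[X]) {d : ℕ} (hd : H.natDegree ≤ d) :
    (aeval (twist α) A H).natDegree ≤ d := by
  rw [aeval_endomorphism]
  exact natDegree_sum_le_of_forall_le _ _ fun i _ =>
    (natDegree_smul_le _ _).trans (natDegree_twist_pow_le α i H hd).1

/-- Translation preserves leading coefficients, so `twist α` is multiplication by `α` plus a
degree-lowering operator. Hence `A` acts invertibly on leading terms when `A.eval α ≠ 0`, and `X - C
α` lowers the degree. -/
theorem coeff_aeval_twist (A : ℂ[X]) (α : ℂ) (H : ℂ[X]) {d : ℕ} (hd : H.natDegree ≤ d) :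
    (aeval (twist α) A H).coeff d = A.eval α * H.coeff d := by
  rw [aeval_endomorphism, Polynomial.sum, finsetSum_coeff, eval_eq_sum, Polynomial.sum,
    Finset.sum_mul]
  refine Finset.sum_congr rfl fun i _ => ?_
  rw [coeff_smul, (natDegree_twist_pow_le α i H hd).2, smul_eq_mul, mul_assoc]

theorem natDegree_aeval_twist (A : ℂ[X]) (α : ℂ) (H : ℂ[X]) (hA : A.eval α ≠ 0) :
    (aeval (twist α) A H).natDegree = H.natDegree := by
  rcases eq_or_ne H 0 with rfl | hH
  · simp
  refine le_antisymm (natDegree_aeval_twist_le A α H le_rfl) (le_natDegree_of_ne_zero ?_)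
  rw [coeff_aeval_twist A α H le_rfl]
  exact mul_ne_zero hA (by simpa using hH)

theorem eq_zero_of_aeval_twist (A : ℂ[X]) (α : ℂ) (H : ℂ[X]) (hA : A.eval α ≠ 0)
    (h : aeval (twist α) A H = 0) : H = 0 := by
  have h1 := coeff_aeval_twist A α H le_rfl
  rw [h, coeff_zero, eq_comm, mul_eq_zero] at h1
  simpa [hA] using h1

theorem natDegree_aeval_twist_X_sub_C_lt (α : ℂ) (H : ℂ[X]) {d : ℕ} (hd : H.natDegree ≤ d + 1) :
    (aeval (twist α) (X - C α) H).natDegree < d + 1 := by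
  have h1 := natDegree_aeval_twist_le (X - C α) α H hd
  have h2 := coeff_aeval_twist (X - C α) α H hd
  rw [eval_sub, eval_X, eval_C, sub_self, zero_mul] at h2
  rcases h1.lt_or_eq with h | h
  · exact h
  · rw [← h, coeff_natDegree, leadingCoeff_eq_zero] at h2
    rw [h2]; simp

theorem aeval_twist_X_sub_C_pow (α : ℂ) {m : ℕ} (H : ℂ[X]) (hm : H.natDegree < m) :
    aeval (twist α) ((X - C α) ^ m) H = 0 := by
  obtain ⟨d, rfl⟩ : ∃ d, m = d + 1 := ⟨m - 1, by omega⟩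
  induction d generalizing H with
  | zero =>
    have h1 := natDegree_aeval_twist_le ((X - C α) ^ (0 + 1)) α H (d := 0) (by omega)
    rw [eq_C_of_natDegree_le_zero h1, coeff_aeval_twist _ _ _ (by omega)]
    simp
  | succ d ih =>
    rw [pow_succ, map_mul, Module.End.mul_apply]
    exact ih _ (natDegree_aeval_twist_X_sub_C_lt α H (by omega))

/-- The exponential polynomial with the given coefficients. -/
noncomputable def expSum : (ℂ →₀ ℂ[X]) →ₗ[ℂ] (ℕ → ℂ) := Finsupp.lsum ℂ expPoly

theorem expSum_single (α : ℂ) (H : ℂ[X]) : expSum (Finsupp.single α H) = expPoly α H := by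
  simp [expSum]

theorem expSum_eq_sum (G : ℂ →₀ ℂ[X]) : expSum G = ∑ β ∈ G.support, expPoly β (G β) := rfl

theorem expSum_apply (G : ℂ →₀ ℂ[X]) (k : ℕ) :
    expSum G k = ∑ β ∈ G.support, (G β).eval (k : ℂ) * β ^ k := by
  simp [expSum_eq_sum, expPoly_apply]

/-- A suitable polynomial in the shift isolates a single component of an exponential polynomial. -/
theorem exists_act_expSum (G : ℂ →₀ ℂ[X]) (α : ℂ) :
    ∃ A : ℂ[X], A.eval α ≠ 0 ∧ act A (expSum G) = expPoly α (aeval (twist α) A (G α)) := by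
  classical
  -- Each factor kills the component at its `β`; omitting `α` keeps `A.eval α ≠ 0`.
  let A : ℂ[X] := ∏ β ∈ G.support.erase α, (X - C β) ^ ((G β).natDegree + 1)
  refine ⟨A, ?_, ?_⟩
  · rw [eval_prod, Finset.prod_ne_zero_iff]
    intro β hβ
    rw [eval_pow, eval_sub, eval_X, eval_C]
    exact pow_ne_zero _ (sub_ne_zero.2 (Finset.ne_of_mem_erase hβ).symm)
  · have h1 : ∀ β ∈ G.support, β ≠ α → act A (expPoly β (G β)) = 0 := by
      intro β hβ hne
      have h2 : A = (∏ γ ∈ (G.support.erase α).erase β, (X - C γ) ^ ((G γ).natDegree + 1)) *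
          (X - C β) ^ ((G β).natDegree + 1) :=
        (Finset.prod_erase_mul _ _ (Finset.mem_erase.2 ⟨hne, hβ⟩)).symm
      rw [h2, act_mul, act_expPoly, aeval_twist_X_sub_C_pow β _ (Nat.lt_succ_self _), map_zero,
        act_zero]
    have h3 : act A (expSum G) = ∑ β ∈ G.support, act A (expPoly β (G β)) := by
      rw [expSum_eq_sum, act, map_sum]; rfl
    rw [h3, Finset.sum_eq_single α h1, act_expPoly]
    intro hα
    rw [Finsupp.notMem_support_iff.1 hα]
    simp [act_zero]

theorem eq_zero_of_expPoly_tendsto {α : ℂ} (hα : 1 ≤ ‖α‖) {H : ℂ[X]}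
    (h : Tendsto (expPoly α H) atTop (nhds 0)) : H = 0 := by
  have h1 : Tendsto (fun k : ℕ => H.eval (k : ℂ)) atTop (nhds 0) := by
    refine squeeze_zero_norm (fun k => ?_) (tendsto_zero_iff_norm_tendsto_zero.1 h)
    rw [expPoly_apply, norm_mul, norm_pow]
    exact le_mul_of_one_le_right (norm_nonneg _) (one_le_pow₀ hα)
  by_contra hH
  by_cases hd : 0 < H.degree
  · have h2 := H.tendsto_norm_atTop hd (z := fun k : ℕ => (k : ℂ)) (l := atTop)
      (by simpa using tendsto_natCast_atTop_atTop (R := ℝ))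
    exact not_tendsto_atTop_of_tendsto_nhds h1.norm h2
  · rw [eq_C_of_degree_le_zero (not_lt.1 hd)] at h1 hH
    simp only [eval_C] at h1
    have := tendsto_nhds_unique h1 tendsto_const_nhds
    exact hH (by rw [← this, C_0])

/-- When `‖α‖ ≥ 1` the exponential factor cannot compensate the growth of a nonconstant `H`; when
`‖α‖ > 1` it forces growth even for a nonzero constant. -/
theorem expPoly_bounded {α : ℂ} (hα : 1 ≤ ‖α‖) {H : ℂ[X]}
    (h : expPoly α H =O[atTop] (fun _ => (1 : ℝ))) :
    H.natDegree = 0 ∧ (1 < ‖α‖ → H = 0) := by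
  have key : ¬ Tendsto (fun k => ‖expPoly α H k‖) atTop atTop := by
    intro h1
    obtain ⟨c, hc⟩ := h.bound
    obtain ⟨k, h2, h3⟩ := (hc.and (h1.eventually_gt_atTop (c * ‖(1 : ℝ)‖))).exists
    linarith
  have hdeg : H.natDegree = 0 := by
    by_contra hd
    refine key ?_
    have h2 := H.tendsto_norm_atTop (natDegree_pos_iff_degree_pos.1 (Nat.pos_of_ne_zero hd))
      (z := fun k : ℕ => (k : ℂ)) (l := atTop)
      (by simpa using tendsto_natCast_atTop_atTop (R := ℝ))
    refine tendsto_atTop_mono (fun k => ?_) h2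
    rw [expPoly_apply, norm_mul, norm_pow]
    exact le_mul_of_one_le_right (norm_nonneg _) (one_le_pow₀ hα)
  refine ⟨hdeg, fun h1 => ?_⟩
  by_contra hH
  rw [eq_C_of_natDegree_eq_zero hdeg] at hH key
  refine key ?_
  simp only [expPoly_apply, eval_C, norm_mul, norm_pow]
  exact (tendsto_pow_atTop_atTop_of_one_lt h1).const_mul_atTop
    (norm_pos_iff.2 fun h0 => hH (by rw [h0, C_0]))

theorem expSum_bounded {G : ℂ →₀ ℂ[X]} (h : expSum G =O[atTop] (fun _ => (1 : ℝ))) {α : ℂ}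
    (hα : 1 ≤ ‖α‖) : (G α).natDegree = 0 ∧ (1 < ‖α‖ → G α = 0) := by
  obtain ⟨A, hA, h1⟩ := exists_act_expSum G α
  have h2 := expPoly_bounded hα (h1 ▸ isBigO_act A h)
  rw [natDegree_aeval_twist A α _ hA] at h2
  exact ⟨h2.1, fun h3 => eq_zero_of_aeval_twist A α _ hA (h2.2 h3)⟩

theorem eq_zero_of_expSum_tendsto {G : ℂ →₀ ℂ[X]} (h : Tendsto (expSum G) atTop (nhds 0)) {α : ℂ}
    (hα : 1 ≤ ‖α‖) : G α = 0 := by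
  obtain ⟨A, hA, h1⟩ := exists_act_expSum G α
  exact eq_zero_of_aeval_twist A α _ hA
    (eq_zero_of_expPoly_tendsto hα (h1 ▸ tendsto_act_zero A h))

/-- Uniqueness of coefficients: once the component is isolated, a polynomial vanishes at all large
integers. The exponent 0 is excluded because its component vanishes from index 1 on, whatever its
coefficient. -/
theorem eq_zero_of_expSum_eventually {G : ℂ →₀ ℂ[X]} (h : expSum G =ᶠ[atTop] 0) {α : ℂ}
    (hα : α ≠ 0) : G α = 0 := by
  obtain ⟨A, hA, h1⟩ := exists_act_expSum G α
  refine eq_zero_of_aeval_twist A α _ hA ?_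
  have h2 := act_eventuallyEq A h
  rw [act_zero, h1] at h2
  obtain ⟨N, hN⟩ := eventually_atTop.1 h2
  refine eq_zero_of_infinite_isRoot _ (Set.Infinite.mono ?_
    ((Set.Ici_infinite N).image (Nat.cast_injective (R := ℂ)).injOn))
  rintro _ ⟨k, hk, rfl⟩
  have h3 := hN k hk
  rw [expPoly_apply] at h3
  exact (mul_eq_zero.1 h3).resolve_right (pow_ne_zero _ hα)

/-- The action of a polynomial on the coefficients of an exponential polynomial. -/
theorem act_expSum (A : ℂ[X]) (G : ℂ →₀ ℂ[X]) :
    ∃ G' : ℂ →₀ ℂ[X], act A (expSum G) = expSum G' ∧ ∀ α, G' α = aeval (twist α) A (G α) := by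
  classical
  refine ⟨Finsupp.onFinset G.support (fun α => aeval (twist α) A (G α)) ?_, ?_, fun α => rfl⟩
  · intro α h
    rw [Finsupp.mem_support_iff]
    rintro h0
    simp [h0] at h
  · have h1 : act A (expSum G) = ∑ β ∈ G.support, act A (expPoly β (G β)) := by
      rw [expSum_eq_sum, act, map_sum]; rfl
    rw [h1, expSum, Finsupp.lsum_apply, Finsupp.onFinset_sum _ (fun a => map_zero _)]
    exact Finset.sum_congr rfl fun β _ => act_expPoly _ _ _

/-- Induction on the degree of `Z`, removing its top coefficient. In the resonant case `α = β` the
operator lowers degrees by one, so the correction needs degree `d + 1`; its top coefficient is then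
multiplied by `α (d + 1)`, whence `α ≠ 0`. -/
theorem exists_aeval_twist_eq {α : ℂ} (hα : α ≠ 0) (β : ℂ) (Z : ℂ[X]) :
    ∃ W : ℂ[X], aeval (twist α) (X - C β) W = Z := by
  obtain ⟨d, hd⟩ : ∃ d, Z.natDegree < d := ⟨_, Nat.lt_succ_self _⟩
  induction d generalizing Z with
  | zero => omega
  | succ d ih =>
    obtain ⟨W, hW1, hW2⟩ : ∃ W : ℂ[X], (aeval (twist α) (X - C β) W).natDegree ≤ d ∧
        (aeval (twist α) (X - C β) W).coeff d = Z.coeff d := by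
      rcases eq_or_ne α β with rfl | hne
      · have h1 : aeval (twist α) (X - C α) (X ^ (d + 1)) =
            α • ((X + 1 : ℂ[X]) ^ (d + 1) - X ^ (d + 1)) := by
          simp [twist_apply, smul_sub, Algebra.algebraMap_eq_smul_one]
        have h2 : (aeval (twist α) (X - C α) (X ^ (d + 1) : ℂ[X])).coeff d = α * (d + 1) := by
          rw [h1, coeff_smul, coeff_sub, coeff_X_add_one_pow, coeff_X_pow]
          simp
        have h3 : (aeval (twist α) (X - C α) (X ^ (d + 1) : ℂ[X])).natDegree ≤ d := by
          have h4 := natDegree_aeval_twist_X_sub_C_lt α (X ^ (d + 1)) (d := d) (by simp)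
          omega
        have h6 : α * ((d : ℂ) + 1) ≠ 0 := mul_ne_zero hα (by exact_mod_cast d.succ_ne_zero)
        refine ⟨(Z.coeff d / (α * (d + 1))) • X ^ (d + 1), ?_, ?_⟩
        · rw [map_smul]
          exact (natDegree_smul_le _ _).trans h3
        · rw [map_smul, coeff_smul, h2, smul_eq_mul, div_mul_cancel₀ _ h6]
      · refine ⟨C (Z.coeff d / (α - β)) * X ^ d, ?_, ?_⟩
        · exact natDegree_aeval_twist_le _ _ _ (natDegree_C_mul_X_pow_le _ _)
        · rw [coeff_aeval_twist _ _ _ (natDegree_C_mul_X_pow_le _ _)]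
          have : α - β ≠ 0 := sub_ne_zero.2 hne
          simp
          field_simp
    have h7 : Z - aeval (twist α) (X - C β) W = 0 ∨
        (Z - aeval (twist α) (X - C β) W).natDegree < d := by
      have h8 : (Z - aeval (twist α) (X - C β) W).natDegree ≤ d :=
        (natDegree_sub_le _ _).trans (max_le (by omega) hW1)
      rcases h8.lt_or_eq with h | h
      · exact Or.inr h
      · left
        rw [← leadingCoeff_eq_zero, leadingCoeff, h, coeff_sub, hW2, sub_self]
    rcases h7 with h7 | h7
    · exact ⟨W, (sub_eq_zero.1 h7).symm⟩
    · obtain ⟨V, hV⟩ := ih _ h7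
      exact ⟨V + W, by rw [map_add, hV, sub_add_cancel]⟩

theorem exists_act_X_sub_C_eq (β : ℂ) (G : ℂ →₀ ℂ[X]) :
    ∃ G' : ℂ →₀ ℂ[X], act (X - C β) (expSum G') =ᶠ[atTop] expSum G := by
  induction G using Finsupp.induction_linear with
  | zero => exact ⟨0, by simp [act_zero]⟩
  | add G₁ G₂ h1 h2 =>
    obtain ⟨G₁', h1⟩ := h1
    obtain ⟨G₂', h2⟩ := h2
    exact ⟨G₁' + G₂', by rw [map_add, map_add, act_add]; exact h1.add h2⟩
  | single α H =>
    rcases eq_or_ne α 0 with rfl | hα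
    · refine ⟨0, ?_⟩
      rw [map_zero, act_zero]
      filter_upwards [eventually_ge_atTop 1] with k hk
      rw [expSum_single, expPoly_apply, zero_pow (by omega)]
      simp
    · obtain ⟨W, hW⟩ := exists_aeval_twist_eq hα β H
      exact ⟨Finsupp.single α W, by rw [expSum_single, expSum_single, act_expPoly, hW]⟩

/-- Solutions of linear recurrences are eventually exponential polynomials. -/
theorem exists_expSum_of_act_eq_zero {P : ℂ[X]} (hP : P ≠ 0) {y : ℕ → ℂ}
    (h : act P y =ᶠ[atTop] 0) : ∃ G, y =ᶠ[atTop] expSum G := by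
  obtain ⟨d, hd⟩ : ∃ d, P.natDegree = d := ⟨_, rfl⟩
  induction d generalizing P y with
  | zero =>
    refine ⟨0, ?_⟩
    rw [eq_C_of_natDegree_eq_zero hd] at h hP
    filter_upwards [h] with k hk
    rw [act_C] at hk
    have : P.coeff 0 ≠ 0 := fun h0 => hP (by rw [h0, C_0])
    simpa [this] using hk
  | succ d ih =>
    obtain ⟨β, hβ⟩ := IsAlgClosed.exists_root P (by
      rw [degree_eq_natDegree hP, hd]; exact_mod_cast d.succ_ne_zero)
    obtain ⟨P', rfl⟩ := dvd_iff_isRoot.2 hβ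
    have hP' : P' ≠ 0 := right_ne_zero_of_mul hP
    rw [natDegree_mul (X_sub_C_ne_zero β) hP', natDegree_X_sub_C] at hd
    rw [act_mul, act_mul_comm] at h
    obtain ⟨G, hG⟩ := ih hP' h (by omega)
    obtain ⟨G', hG'⟩ := exists_act_X_sub_C_eq β G
    have h1 : act (X - C β) (y - expSum G') =ᶠ[atTop] 0 := by
      rw [act_sub]
      filter_upwards [hG, hG'] with k h2 h3
      simp [h2, h3]
    obtain ⟨N, hN⟩ := eventually_atTop.1 h1
    set v := y - expSum G' with hv
    -- After subtracting a particular solution, what remains is eventually geometric with ratio `β`.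
    have h4 : ∀ k, v (N + k) = β ^ k * v N := by
      intro k
      induction k with
      | zero => simp
      | succ k ihk =>
        have := hN (N + k) (by omega)
        rw [act_X_sub_C, Pi.zero_apply, sub_eq_zero, smul_eq_mul, ihk] at this
        rw [← add_assoc, this, pow_succ]; ring
    rcases eq_or_ne β 0 with rfl | h0
    · refine ⟨G', ?_⟩
      filter_upwards [eventually_ge_atTop (N + 1)] with k hk
      have := h4 (k - N)
      rw [zero_pow (by omega), zero_mul, Nat.add_sub_cancel' (by omega)] at this
      rwa [hv, Pi.sub_apply, sub_eq_zero] at this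
    · refine ⟨G' + Finsupp.single β (C (v N / β ^ N)), ?_⟩
      filter_upwards [eventually_ge_atTop N] with k hk
      obtain ⟨j, rfl⟩ := Nat.exists_eq_add_of_le hk
      have h5 := h4 j
      rw [hv, Pi.sub_apply, ← hv, sub_eq_iff_eq_add] at h5
      rw [map_add, expSum_single, Pi.add_apply, expPoly_apply, h5, eval_C, pow_add]
      field_simp
      ring


/-! ### Recurrent integer sequences: integrality and Galois equivariance. -/

theorem expSum_eq_finsuppSum (G : ℂ →₀ ℂ[X]) (k : ℕ) :
    expSum G k = G.sum fun β H => H.eval (k : ℂ) * β ^ k := expSum_apply G k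

/-- Integer solutions of linear recurrences are exponential polynomials whose exponents are
algebraic integers, and whose coefficients are compatible with field automorphisms. -/
theorem exists_expSum_of_int {Y : ℕ → ℤ} {P : ℤ[X]} (hP : P ≠ 0) (h : act P Y =ᶠ[atTop] 0) :
    ∃ G : ℂ →₀ ℂ[X], (fun k => (Y k : ℂ)) =ᶠ[atTop] expSum G ∧
      (∀ β, β ≠ 0 → G β ≠ 0 → IsIntegral ℤ β) ∧
      ∀ (σ : ℂ ≃+* ℂ) (β : ℂ), β ≠ 0 → G (σ β) = (G β).map (σ : ℂ →+* ℂ) := by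
  have hcast : ∀ A : ℤ[X], act (A.map (Int.castRingHom ℂ)) (fun k => (Y k : ℂ)) =
      fun k => ((act A Y k : ℤ) : ℂ) := by
    intro A
    rw [act_map_intCast]
    exact funext fun k => act_comp_addMonoidHom (Int.castAddHom ℂ) A Y k
  obtain ⟨G, hG⟩ := exists_expSum_of_act_eq_zero (P := P.map (Int.castRingHom ℂ))
    (y := fun k => (Y k : ℂ))
    ((Polynomial.map_ne_zero_iff (Int.castRingHom ℂ).injective_int).2 hP) (by
      rw [hcast]
      filter_upwards [h] with k hk
      simp [hk])
  refine ⟨G, hG, fun β h0 hβ => ?_, fun σ β h0 => ?_⟩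
  · obtain ⟨N, hN⟩ := eventually_atTop.1 h
    -- The factor `X ^ N` skips the initial terms, so that the recurrence holds from index 0.
    obtain ⟨A, hA, h1⟩ := exists_monic_act_eq_zero (P := X ^ N * P)
      (mul_ne_zero (pow_ne_zero _ X_ne_zero) hP)
    have h2 := h1 Y (by
      funext k
      rw [act_mul, act_X_pow]
      exact hN _ (by omega))
    obtain ⟨G', h3, h4⟩ := act_expSum (A.map (Int.castRingHom ℂ)) G
    have h5 : expSum G' =ᶠ[atTop] 0 := by
      rw [← h3]
      refine (act_eventuallyEq _ hG).symm.trans ?_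
      rw [hcast, h2]
      exact Eventually.of_forall fun k => by simp
    have h6 := eq_zero_of_expSum_eventually h5 h0
    rw [h4] at h6
    refine ⟨A, hA, ?_⟩
    by_contra h7
    exact hβ (eq_zero_of_aeval_twist _ _ _ (by rwa [eval_map]) h6)
  -- The conjugated data represent `σ(Y k) = Y k`, so uniqueness at nonzero exponents identifies
  -- them with `G`.
  · let G' : ℂ →₀ ℂ[X] :=
      (G.mapRange (Polynomial.map (σ : ℂ →+* ℂ)) (Polynomial.map_zero _)).equivMapDomain σ.toEquiv
    have h1 : expSum G' =ᶠ[atTop] fun k => (Y k : ℂ) := by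
      filter_upwards [hG] with k hk
      have h2 := congrArg σ hk
      rw [map_intCast] at h2
      rw [h2, expSum_eq_finsuppSum, expSum_eq_finsuppSum, Finsupp.sum_equivMapDomain,
        Finsupp.sum_mapRange_index (by simp), map_finsuppSum]
      refine Finsupp.sum_congr fun γ _ => ?_
      rw [map_mul, map_pow]
      congr 1
      rw [eval_map, ← map_natCast (σ : ℂ →+* ℂ) k, eval₂_at_apply]
      simp
    have h2 : expSum (G' - G) =ᶠ[atTop] 0 := by
      filter_upwards [h1, hG] with k h3 h4
      simp [h3, ← h4]
    have h3 := eq_zero_of_expSum_eventually h2 (α := σ β) (by simpa using h0)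
    rw [Finsupp.sub_apply, sub_eq_zero] at h3
    rw [← h3]
    simp [G', Finsupp.equivMapDomain_apply]

/-! ### Comparing the components of `x` with those of an integer sequence. -/

section Components

variable {n : ℕ} {α : Fin n → ℂ} {F : Fin n → ℂ[X]} {x : ℕ → ℝ}

theorem exists_expSum_of_sum (hα : Function.Injective α) (F : Fin n → ℂ[X]) :
    ∃ G : ℂ →₀ ℂ[X], (∀ k, expSum G k = ∑ i, (F i).eval (k : ℂ) * α i ^ k) ∧
      ∀ i, G (α i) = F i := by
  classical
  refine ⟨∑ i, Finsupp.single (α i) (F i), fun k => ?_, fun i => ?_⟩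
  · rw [map_sum, Finset.sum_apply]
    exact Finset.sum_congr rfl fun i _ => by rw [expSum_single, expPoly_apply]
  · rw [Finsupp.finsetSum_apply, Finset.sum_eq_single i]
    · simp
    · intro j _ hj
      exact Finsupp.single_eq_of_ne (fun h => hj (hα h.symm))
    · simp

/-- Comparison of the components of a sequence with those of an integer sequence at bounded
distance. -/
theorem exists_components_of_bounded (hα : Function.Injective α)
    (hx : ∀ᶠ k : ℕ in atTop, (x k : ℂ) = ∑ i, (F i).eval (k : ℂ) * α i ^ k)
    {D : ℕ} {Y : ℕ → ℤ} {P : ℤ[X]} (hP : P ≠ 0) (h : act P Y =ᶠ[atTop] 0)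
    (hb : (fun k => D * x k - Y k) =O[atTop] (fun _ => (1 : ℝ))) :
    ∃ G : ℂ →₀ ℂ[X],
      (∀ β, β ≠ 0 → G β ≠ 0 → IsIntegral ℤ β) ∧
      (∀ (σ : ℂ ≃+* ℂ) (β : ℂ), β ≠ 0 → G (σ β) = (G β).map (σ : ℂ →+* ℂ)) ∧
      (∀ i, 1 ≤ ‖α i‖ → (C (D : ℂ) * F i - G (α i)).natDegree = 0) ∧
      (∀ i, 1 < ‖α i‖ → C (D : ℂ) * F i = G (α i)) ∧
      (∀ N : ℕ, Tendsto (fun k => (D * x (k + N) - Y (k + N)) - (D * x k - Y k)) atTop (nhds 0) →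
        ∀ i, 1 ≤ ‖α i‖ → α i ^ N ≠ 1 → C (D : ℂ) * F i = G (α i)) := by
  obtain ⟨G, hG, h1, h2⟩ := exists_expSum_of_int hP h
  obtain ⟨G₀, h3, h4⟩ := exists_expSum_of_sum hα F
  have h5 : expSum ((D : ℂ) • G₀ - G) =ᶠ[atTop] fun k => ((D * x k - Y k : ℝ) : ℂ) := by
    filter_upwards [hx, hG] with k h6 h7
    simp [h3, h6, ← h7]
  have h6 : expSum ((D : ℂ) • G₀ - G) =O[atTop] (fun _ => (1 : ℝ)) := by
    refine Asymptotics.IsBigO.congr' (f₁ := fun k => ((D * x k - Y k : ℝ) : ℂ)) ?_ h5.symm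
      EventuallyEq.rfl
    exact (Asymptotics.isBigO_of_le _ fun k => by simp only [Complex.norm_real, le_refl]).trans hb
  have h7 : ∀ i, ((D : ℂ) • G₀ - G) (α i) = C (D : ℂ) * F i - G (α i) := by
    intro i
    rw [Finsupp.sub_apply, Finsupp.smul_apply, h4, smul_eq_C_mul]
  refine ⟨G, h1, h2, fun i hi => ?_, fun i hi => ?_, fun N hN i hi hiN => ?_⟩
  · rw [← h7]
    exact (expSum_bounded h6 hi).1
  · rw [← sub_eq_zero, ← h7]
    exact (expSum_bounded h6 hi.le).2 hi
  · obtain ⟨G', h8, h9⟩ := act_expSum (X ^ N - 1) ((D : ℂ) • G₀ - G)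
    have h10 : Tendsto (expSum G') atTop (nhds 0) := by
      have h11 := (Complex.continuous_ofReal.tendsto 0).comp hN
      rw [Complex.ofReal_zero] at h11
      refine h11.congr' ?_
      rw [← h8]
      refine EventuallyEq.trans ?_ (act_eventuallyEq _ h5).symm
      exact Eventually.of_forall fun k => by simp [act_X_pow_sub_one]
    have h12 := eq_zero_of_expSum_tendsto h10 hi
    rw [h9, h7] at h12
    exact sub_eq_zero.1 (eq_zero_of_aeval_twist _ _ _ (by simpa [sub_eq_zero] using hiN) h12)

/-- The conditions on an exponential polynomial that keep it away from integer sequences. -/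
def IsWild {n : ℕ} (α : Fin n → ℂ) (F : Fin n → ℂ[X]) : Prop :=
  (∃ i, F i ≠ 0 ∧ 1 < ‖α i‖ ∧ ¬ IsIntegral ℤ (α i)) ∨
  (∃ i, 1 ≤ (F i).natDegree ∧ ‖α i‖ = 1 ∧ ¬ IsIntegral ℤ (α i)) ∨
  (∃ (i j : Fin n) (σ : ℂ ≃+* ℂ), 1 < ‖α i‖ ∧ 1 < ‖α j‖ ∧ σ (α i) = α j ∧
    (F i).map (σ : ℂ →+* ℂ) ≠ F j) ∨
  (∃ (i j : Fin n) (σ : ℂ ≃+* ℂ), 1 ≤ ‖α i‖ ∧ 1 ≤ ‖α j‖ ∧ σ (α i) = α j ∧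
    1 ≤ ((F i).map (σ : ℂ →+* ℂ) - F j).natDegree)

theorem ne_zero_of_one_le_norm {z : ℂ} (h : 1 ≤ ‖z‖) : z ≠ 0 := by
  rintro rfl
  simp at h
  linarith

theorem map_eq_of_C_mul_eq {D : ℕ} (hD : D ≠ 0) {A B G G' : ℂ[X]} {σ : ℂ ≃+* ℂ}
    (hA : C (D : ℂ) * A = G) (hB : C (D : ℂ) * B = G') (h : G' = G.map (σ : ℂ →+* ℂ)) :
    A.map (σ : ℂ →+* ℂ) = B := by
  have hD' : C (D : ℂ) ≠ 0 := C_ne_zero.2 (Nat.cast_ne_zero.2 hD)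
  refine mul_left_cancel₀ hD' ?_
  rw [hB, h, ← hA, Polynomial.map_mul, map_C]
  simp

/-- A multiple of a wild sequence is not at bounded distance from a recurrent integer sequence. -/
theorem not_isWild_of_bounded (hα : Function.Injective α)
    (hx : ∀ᶠ k : ℕ in atTop, (x k : ℂ) = ∑ i, (F i).eval (k : ℂ) * α i ^ k)
    {D : ℕ} (hD : D ≠ 0) {Y : ℕ → ℤ} {P : ℤ[X]} (hP : P ≠ 0) (h : act P Y =ᶠ[atTop] 0)
    (hb : (fun k => D * x k - Y k) =O[atTop] (fun _ => (1 : ℝ))) : ¬ IsWild α F := by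
  obtain ⟨G, hint, hσ, h1, h2, -⟩ := exists_components_of_bounded hα hx hP h hb
  have hD' : (D : ℂ) ≠ 0 := Nat.cast_ne_zero.2 hD
  rintro (⟨i, hF, hi, hn⟩ | ⟨i, hF, hi, hn⟩ | ⟨i, j, σ, hi, hj, hij, hF⟩ |
    ⟨i, j, σ, hi, hj, hij, hF⟩)
  · refine hn (hint _ (ne_zero_of_one_le_norm hi.le) ?_)
    rw [← h2 i hi]
    exact mul_ne_zero (C_ne_zero.2 hD') hF
  · refine hn (hint _ (ne_zero_of_one_le_norm hi.ge) fun h0 => ?_)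
    have h3 := h1 i hi.ge
    rw [h0, sub_zero, natDegree_C_mul hD'] at h3
    omega
  · refine hF (map_eq_of_C_mul_eq hD (h2 i hi) (h2 j hj) ?_)
    rw [← hij, hσ _ _ (ne_zero_of_one_le_norm hi.le)]
  -- The equivariant contributions of `G` cancel, leaving a difference of two constants.
  · have h3 : C (D : ℂ) * ((F i).map (σ : ℂ →+* ℂ) - F j) =
        (C (D : ℂ) * F i - G (α i)).map (σ : ℂ →+* ℂ) - (C (D : ℂ) * F j - G (α j)) := by
      rw [← hij, hσ _ _ (ne_zero_of_one_le_norm hi), Polynomial.map_sub, Polynomial.map_mul, map_C]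
      simp
      ring
    have h4 := congrArg natDegree h3
    rw [natDegree_C_mul hD'] at h4
    have h5 := natDegree_sub_le ((C (D : ℂ) * F i - G (α i)).map (σ : ℂ →+* ℂ))
      (C (D : ℂ) * F j - G (α j))
    rw [natDegree_map, h1 i hi, h1 j hj, max_self, ← h4] at h5
    omega

/-- Asymptotic periodicity also removes the undetermined constant on the unit circle, except at
`N`-th roots of unity. Since `|α i| > 1`, `α i` is not a root of unity, hence neither is its
conjugate `α j`. -/
theorem map_eq_of_bounded_of_periodic (hα : Function.Injective α)
    (hx : ∀ᶠ k : ℕ in atTop, (x k : ℂ) = ∑ i, (F i).eval (k : ℂ) * α i ^ k)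
    {D : ℕ} (hD : D ≠ 0) {Y : ℕ → ℤ} {P : ℤ[X]} (hP : P ≠ 0) (h : act P Y =ᶠ[atTop] 0)
    (hb : (fun k => D * x k - Y k) =O[atTop] (fun _ => (1 : ℝ))) {N : ℕ} (hN : N ≠ 0)
    (hper : Tendsto (fun k => (D * x (k + N) - Y (k + N)) - (D * x k - Y k)) atTop (nhds 0))
    {i j : Fin n} {σ : ℂ ≃+* ℂ} (hi : 1 < ‖α i‖) (hj : 1 ≤ ‖α j‖) (hij : σ (α i) = α j) :
    (F i).map (σ : ℂ →+* ℂ) = F j := by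
  obtain ⟨G, hint, hσ, h1, h2, h3⟩ := exists_components_of_bounded hα hx hP h hb
  have h4 : α i ^ N ≠ 1 := fun h0 => by
    have := congrArg norm h0
    rw [norm_pow, norm_one] at this
    exact (one_lt_pow₀ hi hN).ne' this
  refine map_eq_of_C_mul_eq hD (h2 i hi) (h3 N hper j hj ?_) ?_
  · rw [← hij, ← map_pow]
    exact fun h0 => h4 (σ.injective (h0.trans (map_one σ).symm))
  · rw [← hij, hσ _ _ (ne_zero_of_one_le_norm hi.le)]

end Components

/-! ### The lower bound for the limsup. -/

theorem abs_act_le {A : ℝ[X]} {g : ℕ → ℝ} {k : ℕ} {c : ℝ} (h : ∀ i, |g (k + i)| ≤ c) :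
    |act A g k| ≤ polyLength A * c := by
  rw [act_apply_range, polyLength, Finset.sum_mul]
  refine (Finset.abs_sum_le_sum_abs _ _).trans (Finset.sum_le_sum fun i _ => ?_)
  rw [smul_eq_mul, abs_mul]
  exact mul_le_mul_of_nonneg_left (h i) (abs_nonneg _)

theorem polyLength_nonneg (A : ℝ[X]) : 0 ≤ polyLength A :=
  Finset.sum_nonneg fun _ _ => abs_nonneg _

theorem eq_zero_of_abs_lt_one {m : ℤ} (h : |(m : ℝ)| < 1) : m = 0 := by
  rw [← Int.abs_lt_one_iff]
  exact_mod_cast h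

theorem exists_recurrent_of_limsup_lt {R : ℤ[X]} {x : ℕ → ℝ}
    (hx : act R x =ᶠ[atTop] 0)
    (h : limsup (fun k : ℕ => distNearestInt (x k)) atTop <
      1 / polyLength (R.map (Int.castRingHom ℝ))) :
    ∃ Y : ℕ → ℤ, act R Y =ᶠ[atTop] 0 ∧
      (fun k => x k - Y k) =O[atTop] (fun _ => (1 : ℝ)) := by
  set L := polyLength (R.map (Int.castRingHom ℝ)) with hL
  have hhalf : ∀ t : ℝ, distNearestInt t ≤ 1 / 2 := fun t => abs_sub_round t
  have h0 : 0 ≤ limsup (fun k : ℕ => distNearestInt (x k)) atTop :=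
    le_limsup_of_frequently_le (Frequently.of_forall fun k => abs_nonneg _)
      (isBoundedUnder_of ⟨1 / 2, fun k => hhalf _⟩)
  have hLpos : 0 < L := by
    by_contra hneg
    exact absurd (h0.trans_lt h) (not_lt.2 (one_div_nonpos.2 (not_lt.1 hneg)))
  obtain ⟨c, h1, h2⟩ := exists_between h
  have h3 := eventually_lt_of_limsup_lt h1 (isBoundedUnder_of ⟨1 / 2, fun k => hhalf _⟩)
  refine ⟨fun k => round (x k), ?_, ?_⟩
  · obtain ⟨N, hN⟩ := eventually_atTop.1 h3
    filter_upwards [hx, eventually_ge_atTop N] with k h4 hk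
    refine eq_zero_of_abs_lt_one ?_
    -- As `R` annihilates `x`, this integer is determined by the rounding errors, which are
    -- eventually below `c < 1 / L`.
    have h5 : ((act R (fun k => round (x k)) k : ℤ) : ℝ) =
        - act (R.map (Int.castRingHom ℝ)) (fun k => x k - round (x k)) k := by
      have h6 := act_comp_addMonoidHom (Int.castAddHom ℝ) R (fun k => round (x k)) k
      have h7 : (fun k => x k - round (x k)) =
        x - fun k => (Int.castAddHom ℝ) (round (x k)) := rfl
      rw [act_map_intCast, h7, act_sub, Pi.sub_apply, h4, h6]
      simp
    rw [h5, abs_neg]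
    refine (abs_act_le (c := c) fun i => ?_).trans_lt ?_
    · exact (hN (k + i) (by omega)).le
    · rw [← hL]
      rwa [lt_div_iff₀ hLpos, mul_comm] at h2
  · refine Asymptotics.IsBigO.of_bound 1 (Eventually.of_forall fun k => ?_)
    have := hhalf (x k)
    simp only [distNearestInt] at this
    simp only [Real.norm_eq_abs, abs_one]
    linarith


/-! ### Finitely many limit values. -/

theorem finite_range_act {K M : Type*} [CommRing K] [AddCommGroup M] [Module K M] (A : K[X])
    {g : ℕ → M} (h : (Set.range g).Finite) : (Set.range (act A g)).Finite := by
  have := h.to_subtype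
  have h1 : act A g =
      (fun v : Fin (A.natDegree + 1) → Set.range g =>
        ∑ i : Fin (A.natDegree + 1), A.coeff i • (v i : M)) ∘
      fun k i => ⟨g (k + i), k + i, rfl⟩ := by
    funext k
    rw [act_apply_range, Finset.sum_range]
    rfl
  rw [h1, Set.range_comp]
  exact Set.toFinite _

theorem eventually_eq_of_tendsto_of_finite {X : Type*} [TopologicalSpace X] [T1Space X]
    {f : ℕ → X} (h : (Set.range f).Finite) {a : X} (ha : Tendsto f atTop (nhds a)) :
    ∀ᶠ k in atTop, f k = a := by
  have h1 : (Set.range f \ {a})ᶜ ∈ nhds a :=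
    (h.subset Set.sdiff_subset).isClosed.isOpen_compl.mem_nhds (by simp)
  filter_upwards [ha h1] with k hk
  by_contra hne
  exact hk ⟨⟨k, rfl⟩, hne⟩

/-- A solution of a linear recurrence with finitely many values is eventually periodic. -/
theorem exists_period_of_act_eq_zero {M : Type*} [AddCommGroup M] [Module.IsTorsionFree ℤ M]
    {R : ℤ[X]} (hR : R ≠ 0) {p : ℕ → M} (hp : (Set.range p).Finite) (h : act R p =ᶠ[atTop] 0) :
    ∃ N, N ≠ 0 ∧ ∀ᶠ k in atTop, p (k + N) = p k := by
  obtain ⟨K, hK⟩ := eventually_atTop.1 h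
  have := hp.to_subtype
  let s : ℕ → (Fin R.natDegree → Set.range p) := fun j i => ⟨p (K + j + i), _, rfl⟩
  obtain ⟨a, b, hab, hs⟩ : ∃ a b, a < b ∧ s a = s b := by
    obtain ⟨a, b, hne, hs⟩ := Finite.exists_ne_map_eq_of_infinite s
    rcases hne.lt_or_gt with h | h
    exacts [⟨a, b, h, hs⟩, ⟨b, a, h, hs.symm⟩]
  refine ⟨b - a, by omega, eventually_atTop.2 ⟨K + a, fun k hk => ?_⟩⟩
  have h1 := eq_zero_of_act_eq_zero hR (g := act (X ^ (b - a) - 1 : ℤ[X]) p) (m := K + a)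
    (fun k hk => ?_) (fun i hi => ?_) k hk
  · rwa [act_X_pow_sub_one, sub_eq_zero] at h1
  · rw [act_mul_comm, act_X_pow_sub_one, hK _ (by omega), hK _ (by omega)]
    simp
  · have h2 := congrArg Subtype.val (congrFun hs ⟨i, hi⟩)
    simp only [s] at h2
    rw [act_X_pow_sub_one, h2, show K + a + i + (b - a) = K + b + i by omega, sub_self]

/-- Compactness of the circle: infinitely many terms outside `U` would accumulate outside `U`. -/
theorem eventually_mem_of_limitValues_subset {x : ℕ → ℝ} {U : Set UnitAddCircle} (hU : IsOpen U)
    (h : limitValuesModOne x ⊆ U) : ∀ᶠ k in atTop, (x k : UnitAddCircle) ∈ U := by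
  by_contra hne
  rw [not_eventually] at hne
  obtain ⟨z, hz, hz'⟩ := hU.isClosed_compl.isCompact.exists_mapClusterPt_of_frequently hne
  exact hz (h hz')

theorem limitValuesModOne_nonempty (x : ℕ → ℝ) : (limitValuesModOne x).Nonempty := by
  rw [Set.nonempty_iff_ne_empty]
  intro h
  obtain ⟨k, hk⟩ := (eventually_mem_of_limitValues_subset isOpen_empty h.subset).exists
  exact hk

theorem exists_real_lift (z : UnitAddCircle) : ∃ t : ℝ, (t : UnitAddCircle) = z ∧ |t| = ‖z‖ := by
  obtain ⟨t, rfl⟩ := QuotientAddGroup.mk_surjective z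
  refine ⟨t - round t, ?_, (UnitAddCircle.norm_eq).symm⟩
  have : ((round t : ℝ) : UnitAddCircle) = 0 :=
    (AddCircle.coe_eq_zero_iff 1).2 ⟨round t, by simp⟩
  rw [AddCircle.coe_sub, this, sub_zero]

theorem exists_rat_linearMap : ∃ φ : ℝ →ₗ[ℚ] ℚ, φ 1 = 1 := by
  obtain ⟨φ, hφ⟩ := LinearMap.exists_leftInverse_of_injective
    ((Algebra.linearMap ℚ ℝ)) (LinearMap.ker_eq_bot.2 (algebraMap ℚ ℝ).injective)
  exact ⟨φ, by simpa using LinearMap.congr_fun hφ 1⟩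

/-- A recurrent sequence with finitely many limit values modulo one is close to a recurrent sequence
of rational numbers with bounded denominators. -/
theorem exists_recurrent_of_finite {R : ℤ[X]} (hR : R ≠ 0) {x : ℕ → ℝ}
    (hx : act R x =ᶠ[atTop] 0) (hE : (limitValuesModOne x).Finite) :
    ∃ (D : ℕ) (Y : ℕ → ℤ), D ≠ 0 ∧ act R Y =ᶠ[atTop] 0 ∧
      (fun k => D * x k - Y k) =O[atTop] (fun _ => (1 : ℝ)) ∧
      ∃ N, N ≠ 0 ∧ Tendsto (fun k => (D * x (k + N) - Y (k + N)) - (D * x k - Y k)) atTop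
        (nhds 0) := by
  set E := limitValuesModOne x with hEdef
  choose e heE he using fun k =>
    Set.exists_min_image E (fun z => ‖(x k : UnitAddCircle) - z‖) hE (limitValuesModOne_nonempty x)
  choose δ hδ hδn using fun k => exists_real_lift ((x k : UnitAddCircle) - e k)
  choose L hL using fun z : UnitAddCircle => QuotientAddGroup.mk_surjective z
  have hδ0 : Tendsto δ atTop (nhds 0) := by
    rw [Metric.tendsto_nhds]
    intro ε hε
    filter_upwards [eventually_mem_of_limitValues_subset (x := x) Metric.isOpen_thickening
      (Metric.self_subset_thickening hε E)] with k hk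
    obtain ⟨z, hz, hd⟩ := Metric.mem_thickening_iff.1 hk
    rw [dist_zero_right, Real.norm_eq_abs, hδn]
    exact (he k z hz).trans_lt (by rwa [← dist_eq_norm])
  have hy : ∀ k, ∃ m : ℤ, x k - δ k = m + L (e k) := by
    intro k
    have h1 : ((x k - δ k - L (e k) : ℝ) : UnitAddCircle) = 0 := by
      rw [AddCircle.coe_sub, AddCircle.coe_sub, hδ,
        show ((L (e k) : ℝ) : UnitAddCircle) = e k from hL _]
      abel
    obtain ⟨m, hm⟩ := (AddCircle.coe_eq_zero_iff 1).1 h1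
    refine ⟨m, ?_⟩
    rw [zsmul_one] at hm
    linarith
  choose y hy using hy
  have hfin : (Set.range e).Finite := hE.subset (Set.range_subset_iff.2 heE)
  -- the error term satisfies the recurrence
  have hRδ : act R δ =ᶠ[atTop] 0 := by
    let q : ℝ →+ UnitAddCircle := QuotientAddGroup.mk' _
    have h1 : e = (fun k => q (x k)) - fun k => q (δ k) := by
      funext k
      have : q (δ k) = q (x k) - e k := hδ k
      rw [Pi.sub_apply, this, sub_sub_cancel]
    have hq : Continuous q := AddCircle.continuous_mk' 1
    have hδR : Tendsto (act R δ) atTop (nhds 0) := tendsto_act_zero R hδ0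
    have h2 : Tendsto (fun k => q (act R δ k)) atTop (nhds 0) := by
      have := (hq.tendsto 0).comp hδR
      rwa [map_zero] at this
    have h3 : act R e =ᶠ[atTop] fun k => - q (act R δ k) := by
      filter_upwards [hx] with k hk
      rw [h1, act_sub, Pi.sub_apply, act_comp_addMonoidHom, act_comp_addMonoidHom, hk]
      simp
    have h4 : Tendsto (act R e) atTop (nhds 0) := by
      have := h2.neg
      rw [neg_zero] at this
      exact this.congr' h3.symm
    -- `act R e` tends to zero and takes finitely many values, so it vanishes eventually. Then `act
    -- R δ` is an integer, and being small it is zero.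
    filter_upwards [h3, eventually_eq_of_tendsto_of_finite (finite_range_act R hfin) h4,
      (Metric.tendsto_nhds.1 hδR) 1 one_pos] with k h5 h6 h7
    rw [h6, eq_comm, neg_eq_zero] at h5
    obtain ⟨m, hm⟩ := (AddCircle.coe_eq_zero_iff 1).1 h5
    rw [zsmul_one] at hm
    rw [dist_zero_right, Real.norm_eq_abs, ← hm] at h7
    rw [← hm, eq_zero_of_abs_lt_one h7]
    simp
  have hx' : act R (x - δ) =ᶠ[atTop] 0 := by
    rw [act_sub]
    filter_upwards [hx, hRδ] with k h1 h2
    simp [h1, h2]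
  obtain ⟨φ, hφ⟩ := exists_rat_linearMap
  let D : ℕ := ∏ z ∈ hE.toFinset, (φ (L z)).den
  have hD : D ≠ 0 := Finset.prod_ne_zero_iff.2 fun z _ => (φ (L z)).den_nz
  have hm : ∀ z : UnitAddCircle, ∃ m : ℤ, z ∈ E → (m : ℚ) = D * φ (L z) := by
    intro z
    by_cases hz : z ∈ E
    · obtain ⟨t, ht⟩ : (φ (L z)).den ∣ D := Finset.dvd_prod_of_mem _ (hE.mem_toFinset.2 hz)
      refine ⟨t * (φ (L z)).num, fun _ => ?_⟩
      rw [ht]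
      push_cast
      rw [mul_right_comm, Rat.den_mul_eq_num]
      ring
    · exact ⟨0, fun h => absurd h hz⟩
  choose m hm using hm
  let Y : ℕ → ℤ := fun k => D * y k + m (e k)
  -- `ψ` is additive and maps `x - δ` to `Y`, so `Y` inherits the recurrence.
  let ψ : ℝ →+ ℚ := (AddMonoidHom.mulLeft (D : ℚ)).comp φ.toAddMonoidHom
  have hY : ∀ k, Int.castAddHom ℚ (Y k) = ψ ((x - δ) k) := by
    intro k
    have h1 : φ (y k : ℝ) = y k := by
      have := map_zsmul φ (y k) (1 : ℝ)
      rwa [hφ, zsmul_one, zsmul_one] at this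
    have h2 : ψ ((x - δ) k) = D * φ (y k + L (e k)) := by
      rw [Pi.sub_apply, hy]; rfl
    rw [h2, map_add φ (y k : ℝ) (L (e k)), h1, mul_add, ← hm _ (heE k)]
    simp [Y]
  have hYR : act R Y =ᶠ[atTop] 0 := by
    filter_upwards [hx'] with k hk
    have h1 := act_comp_addMonoidHom (Int.castAddHom ℚ) R Y k
    simp only [hY] at h1
    rw [act_comp_addMonoidHom, hk, Pi.zero_apply, map_zero] at h1
    exact Int.cast_injective (h1.symm.trans Int.cast_zero.symm)
  -- `D x - Y` is `p + D δ`, where `p` has finitely many values and satisfies the recurrence, hence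
  -- is eventually periodic.
  let p : ℕ → ℝ := fun k => D * L (e k) - m (e k)
  have hp : (Set.range p).Finite := by
    have : p = (fun z => D * L z - m z) ∘ e := rfl
    rw [this, Set.range_comp]
    exact hfin.image _
  have hpb : ∀ k, D * x k - Y k = p k + D * δ k := by
    intro k
    have := hy k
    have h2 : x k = y k + L (e k) + δ k := by linarith
    simp only [h2, p, Y]
    push_cast
    ring
  have hpR : act R p =ᶠ[atTop] 0 := by
    have h1 : p = (fun k => AddMonoidHom.mulLeft (D : ℝ) ((x - δ) k)) -
        fun k => Int.castAddHom ℝ (Y k) := by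
      funext k
      have := hpb k
      simp only [Pi.sub_apply, AddMonoidHom.coe_mulLeft, Int.coe_castAddHom]
      linarith
    filter_upwards [hx', hYR] with k h2 h3
    rw [h1, act_sub, Pi.sub_apply, act_comp_addMonoidHom, act_comp_addMonoidHom, h2, h3]
    simp
  obtain ⟨N, hN, hper⟩ := exists_period_of_act_eq_zero hR hp hpR
  refine ⟨D, Y, hD, hYR, ?_, N, hN, ?_⟩
  · simp only [hpb]
    refine Asymptotics.IsBigO.add ?_ ?_
    · obtain ⟨c, hc⟩ := hp.isBounded.exists_norm_le
      exact Asymptotics.IsBigO.of_bound c (Eventually.of_forall fun k => by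
        simpa using hc _ ⟨k, rfl⟩)
    · exact (hδ0.isBigO_one ℝ).const_mul_left _
  · have h1 : Tendsto (fun k => (D : ℝ) * (δ (k + N) - δ k)) atTop (nhds 0) := by
      have := ((hδ0.comp (tendsto_add_atTop_nat N)).sub hδ0).const_mul (D : ℝ)
      simpa using this
    refine h1.congr' ?_
    filter_upwards [hper] with k hk
    rw [hpb, hpb, hk]
    ring


/-! ### Periodicity from small oscillation. -/

/-- The sequence is an orbit of a self-map of a finite set, and two iterates of that map coincide.
-/
theorem exists_period_of_forward {S : Type*} [Finite S] {s : ℕ → S}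
    (h : ∀ a b, s a = s b → s (a + 1) = s (b + 1)) :
    ∃ N, N ≠ 0 ∧ ∀ᶠ k in atTop, s (k + N) = s k := by
  have : Nonempty S := ⟨s 0⟩
  obtain ⟨f, hf⟩ := (Function.factorsThrough_iff (fun k => s (k + 1))).1
    (fun a b hab => h a b hab : Function.FactorsThrough (fun k => s (k + 1)) s)
  have hf' : ∀ n k, s (k + n) = f^[n] (s k) := by
    intro n
    induction n with
    | zero => simp
    | succ n ih =>
      intro k
      rw [Function.iterate_succ_apply', ← ih]
      exact congrFun hf (k + n)
  obtain ⟨a, b, hab, h1⟩ : ∃ a b, a < b ∧ f^[a] = f^[b] := by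
    obtain ⟨a, b, hne, h1⟩ := Finite.exists_ne_map_eq_of_infinite fun n : ℕ => f^[n]
    rcases hne.lt_or_gt with h | h
    exacts [⟨a, b, h, h1⟩, ⟨b, a, h, h1.symm⟩]
  refine ⟨b - a, by omega, eventually_atTop.2 ⟨a, fun k hk => ?_⟩⟩
  obtain ⟨j, rfl⟩ := Nat.exists_eq_add_of_le' hk
  rw [hf' a, h1, ← hf' b]
  congr 1
  omega

/-- The same argument with time reversed: each state determines its predecessor. This serves the
case where `S` has constant coefficient 1. -/
theorem exists_period_of_backward {S : Type*} [Finite S] {s : ℕ → S}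
    (h : ∀ a b, s (a + 1) = s (b + 1) → s a = s b) :
    ∃ N, N ≠ 0 ∧ ∀ᶠ k in atTop, s (k + N) = s k := by
  have : Nonempty S := ⟨s 0⟩
  obtain ⟨f, hf⟩ := (Function.factorsThrough_iff s).1
    (fun a b hab => h a b hab : Function.FactorsThrough s (fun k => s (k + 1)))
  have hf' : ∀ n k, s k = f^[n] (s (k + n)) := by
    intro n
    induction n with
    | zero => simp
    | succ n ih =>
      intro k
      rw [Function.iterate_succ_apply, ih k]
      exact congrArg _ (congrFun hf (k + n))
  obtain ⟨a, b, hab, h1⟩ : ∃ a b, a < b ∧ f^[a] = f^[b] := by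
    obtain ⟨a, b, hne, h1⟩ := Finite.exists_ne_map_eq_of_infinite fun n : ℕ => f^[n]
    rcases hne.lt_or_gt with h | h
    exacts [⟨a, b, h, h1⟩, ⟨b, a, h, h1.symm⟩]
  refine ⟨b - a, by omega, Eventually.of_forall fun k => ?_⟩
  rw [hf' b k, hf' a (k + (b - a)), h1]
  congr 2
  omega

theorem act_sub_act (A : ℝ[X]) (g : ℕ → ℝ) (k k' : ℕ) :
    act A g k - act A g k' =
      ∑ i ∈ Finset.range (A.natDegree + 1), A.coeff i * (g (k + i) - g (k' + i)) := by
  rw [act_apply_range, act_apply_range, ← Finset.sum_sub_distrib]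
  exact Finset.sum_congr rfl fun i _ => by rw [smul_eq_mul, smul_eq_mul, mul_sub]

theorem abs_act_sub_act_le {A : ℝ[X]} {g : ℕ → ℝ} {k k' : ℕ} {c : ℝ}
    (h : ∀ i, |g (k + i) - g (k' + i)| ≤ c) : |act A g k - act A g k'| ≤ polyLength A * c := by
  rw [act_sub_act, polyLength, Finset.sum_mul]
  refine (Finset.abs_sum_le_sum_abs _ _).trans (Finset.sum_le_sum fun i _ => ?_)
  rw [abs_mul]
  exact mul_le_mul_of_nonneg_left (h i) (abs_nonneg _)

theorem eq_of_abs_sub_lt_one {m m' : ℤ} (h : |(m : ℝ) - m'| < 1) : m = m' :=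
  sub_eq_zero.1 (eq_zero_of_abs_lt_one (by exact_mod_cast h))

/-- An integer sequence with finitely many values is eventually periodic if a linear combination of
neighbouring terms oscillates by less than one along each residue class. -/
theorem exists_period_of_oscillation {w : ℕ → ℤ} (hw : (Set.range w).Finite) {S : ℝ[X]}
    (hS : S.leadingCoeff = 1 ∨ S.coeff 0 = 1) {M K : ℕ} (hM : M ≠ 0)
    (h : ∀ k k', K ≤ k → K ≤ k' → (k : ZMod M) = k' →
      |act S (fun k => (w k : ℝ)) k - act S (fun k => (w k : ℝ)) k'| < 1) :
    ∃ N, N ≠ 0 ∧ ∀ᶠ k in atTop, w (k + N) = w k := by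
  have := hw.to_subtype
  have : NeZero M := ⟨hM⟩
  -- Consecutive windows share all but one term. That term carries the coefficient 1 of `S`, so when
  -- the other terms agree the oscillation bound forces two integers at distance < 1 to be equal.
  -- The residue modulo `M` makes the bound applicable.
  let s : ℕ → (Fin (S.natDegree + 1) → Set.range w) × ZMod M :=
    fun j => (fun i => ⟨w (K + j + i), _, rfl⟩, ((K + j : ℕ) : ZMod M))
  have hs : ∀ a b, s a = s b ↔ (∀ i < S.natDegree + 1, w (K + a + i) = w (K + b + i)) ∧
      ((K + a : ℕ) : ZMod M) = (K + b : ℕ) := by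
    intro a b
    simp only [s, Prod.mk.injEq, funext_iff]
    exact and_congr_left fun _ => ⟨fun h i hi => congrArg Subtype.val (h ⟨i, hi⟩),
      fun h i => Subtype.ext (h i i.2)⟩
  suffices hper : ∃ N, N ≠ 0 ∧ ∀ᶠ k in atTop, s (k + N) = s k by
    obtain ⟨N, hN, h1⟩ := hper
    obtain ⟨J, hJ⟩ := eventually_atTop.1 h1
    refine ⟨N, hN, eventually_atTop.2 ⟨K + J, fun k hk => ?_⟩⟩
    obtain ⟨j, rfl⟩ := Nat.exists_eq_add_of_le hk
    have := ((hs _ _).1 (hJ (J + j) (by omega))).1 0 (by omega)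
    rwa [add_zero, add_zero, ← add_assoc, ← add_assoc] at this
  rcases hS with hS | hS
  · refine exists_period_of_forward fun a b hab => ?_
    rw [hs] at hab ⊢
    obtain ⟨h1, h2⟩ := hab
    have h3 : ((K + (a + 1) : ℕ) : ZMod M) = (K + (b + 1) : ℕ) := by
      rw [← add_assoc, ← add_assoc, Nat.cast_succ, h2, Nat.cast_succ]
    refine ⟨fun i hi => ?_, h3⟩
    rcases Nat.lt_succ_iff_lt_or_eq.1 hi with hi | rfl
    · have := h1 (i + 1) (by omega)
      rwa [show K + (a + 1) + i = K + a + (i + 1) by omega,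
        show K + (b + 1) + i = K + b + (i + 1) by omega]
    · have h4 := h (K + (a + 1)) (K + (b + 1)) (by omega) (by omega) h3
      rw [act_sub_act, Finset.sum_range_succ, Finset.sum_eq_zero, zero_add, coeff_natDegree, hS,
        one_mul] at h4
      · exact eq_of_abs_sub_lt_one h4
      · intro i hi
        have := h1 (i + 1) (by have := Finset.mem_range.1 hi; omega)
        rw [show K + (a + 1) + i = K + a + (i + 1) by omega,
          show K + (b + 1) + i = K + b + (i + 1) by omega, this, sub_self, mul_zero]
  · refine exists_period_of_backward fun a b hab => ?_
    rw [hs] at hab ⊢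
    obtain ⟨h1, h2⟩ := hab
    have h3 : ((K + a : ℕ) : ZMod M) = (K + b : ℕ) := by
      rw [← add_assoc, ← add_assoc, Nat.cast_succ, Nat.cast_succ] at h2
      exact add_right_cancel h2
    refine ⟨fun i hi => ?_, h3⟩
    rcases Nat.eq_zero_or_pos i with rfl | hi0
    · have h4 := h (K + a) (K + b) (by omega) (by omega) h3
      rw [act_sub_act, Finset.sum_range_succ', Finset.sum_eq_zero, zero_add, hS, one_mul] at h4
      · exact eq_of_abs_sub_lt_one h4
      · intro i hi
        have := h1 i (by have := Finset.mem_range.1 hi; omega)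
        rw [show K + a + (i + 1) = K + (a + 1) + i by omega,
          show K + b + (i + 1) = K + (b + 1) + i by omega, this, sub_self, mul_zero]
    · have := h1 (i - 1) (by omega)
      rwa [show K + a + i = K + (a + 1) + (i - 1) by omega,
        show K + b + i = K + (b + 1) + (i - 1) by omega]

/-! ### Removable factors and asymptotic periodicity. -/

theorem expPoly_tendsto_zero {α : ℂ} (hα : ‖α‖ < 1) (H : ℂ[X]) :
    Tendsto (expPoly α H) atTop (nhds 0) := by
  induction H using Polynomial.induction_on' with
  | add p q hp hq =>
    rw [map_add, ← add_zero (0 : ℂ)]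
    exact hp.add hq
  | monomial n a =>
    have h1 := (tendsto_pow_const_mul_const_pow_of_abs_lt_one n
      (r := ‖α‖) (by rwa [abs_norm])).const_mul ‖a‖
    rw [mul_zero] at h1
    refine squeeze_zero_norm (fun k => ?_) h1
    rw [expPoly_apply, eval_monomial, norm_mul, norm_mul, norm_pow, norm_pow, Complex.norm_natCast,
      mul_assoc]

/-- Solutions of a recurrence all of whose characteristic roots have modulus less than one tend to
zero. -/
theorem tendsto_zero_of_act_eq_zero {B : ℂ[X]} (hB : B ≠ 0) (hroots : ∀ z, B.IsRoot z → ‖z‖ < 1)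
    {g : ℕ → ℂ} (h : act B g =ᶠ[atTop] 0) : Tendsto g atTop (nhds 0) := by
  obtain ⟨G, hG⟩ := exists_expSum_of_act_eq_zero hB h
  refine Tendsto.congr' hG.symm ?_
  obtain ⟨G', h1, h2⟩ := act_expSum B G
  have h3 : expSum G' =ᶠ[atTop] 0 := h1 ▸ (act_eventuallyEq B hG).symm.trans h
  have h4 : expSum G = fun k => ∑ β ∈ G.support, expPoly β (G β) k := by
    funext k
    rw [expSum_eq_sum, Finset.sum_apply]
  rw [h4, ← Finset.sum_const_zero (s := G.support)]
  refine tendsto_finsetSum _ fun β hβ => expPoly_tendsto_zero ?_ _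
  by_contra hlt
  have h5 := eq_zero_of_expSum_eventually h3 (ne_zero_of_one_le_norm (not_lt.1 hlt))
  rw [h2] at h5
  exact Finsupp.mem_support_iff.1 hβ
    (eq_zero_of_aeval_twist _ _ _ (fun h0 => hlt (hroots β h0)) h5)

/-- A removable factor divides a product of some `X ^ N - 1` and a polynomial all of whose roots
have modulus less than one. -/
theorem exists_dvd_of_isRemovableFactor {Q : ℤ[X]} (hQ : Q ≠ 0) (h : IsRemovableFactor Q) :
    ∃ (N : ℕ) (B : ℂ[X]), N ≠ 0 ∧ B ≠ 0 ∧ (∀ z, B.IsRoot z → ‖z‖ < 1) ∧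
      Q.map (Int.castRingHom ℂ) ∣ (X ^ N - 1) * B := by
  classical
  set q := Q.map (Int.castRingHom ℂ) with hq
  have hq0 : q ≠ 0 := (Polynomial.map_ne_zero_iff (Int.castRingHom ℂ).injective_int).2 hQ
  let p : ℂ → Prop := fun z => ∃ m : ℕ, 1 ≤ m ∧ z ^ m = 1
  have hord : ∀ z, ∃ m : ℕ, 1 ≤ m ∧ (p z → z ^ m = 1) := by
    intro z
    by_cases hz : p z
    · obtain ⟨m, hm, h1⟩ := hz
      exact ⟨m, hm, fun _ => h1⟩
    · exact ⟨1, le_rfl, fun h => absurd h hz⟩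
  choose o ho1 ho using hord
  let N := ∏ z ∈ q.roots.toFinset, o z
  have hN : N ≠ 0 := Finset.prod_ne_zero_iff.2 fun z _ => by have := ho1 z; omega
  have hXN : (X ^ N - 1 : ℂ[X]) ≠ 0 := by
    simpa using X_pow_sub_C_ne_zero (Nat.pos_of_ne_zero hN) (1 : ℂ)
  -- The roots of unity, being simple, form a product dividing `X ^ N - 1`; all other roots go into
  -- `B`.
  let U := (q.roots.filter p).map fun a => X - C a
  let V := (q.roots.filter fun z => ¬ p z).map fun a => X - C a
  have hprod : q = U.prod * (C q.leadingCoeff * V.prod) := by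
    conv_lhs => rw [(IsAlgClosed.splits q).eq_prod_roots]
    rw [← Multiset.filter_add_not p q.roots, Multiset.map_add, Multiset.prod_add]
    exact mul_left_comm _ _ _
  have hB : C q.leadingCoeff * V.prod ≠ 0 := fun h0 => hq0 (by rw [hprod, h0, mul_zero])
  refine ⟨N, C q.leadingCoeff * V.prod, hN, hB, fun z hz => ?_, ?_⟩
  · have h1 : V.prod.IsRoot z := by
      rcases root_mul.1 hz with h2 | h2
      · simp [hq0] at h2
      · exact h2
    have h2 : z ∈ V.prod.roots := (mem_roots (right_ne_zero_of_mul hB)).2 h1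
    rw [roots_multiset_prod_X_sub_C, Multiset.mem_filter] at h2
    exact ((h z ((mem_roots hq0).1 h2.1)).1).resolve_left h2.2
  · conv_lhs => rw [hprod]
    refine mul_dvd_mul_right ?_ _
    rw [Multiset.prod_X_sub_C_dvd_iff_le_roots hXN, Multiset.le_iff_subset]
    · intro z hz
      rw [Multiset.mem_filter] at hz
      rw [mem_roots hXN, IsRoot.def, eval_sub, eval_pow, eval_X, eval_one, sub_eq_zero]
      obtain ⟨t, ht⟩ : o z ∣ N := Finset.dvd_prod_of_mem _ (Multiset.mem_toFinset.2 hz.1)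
      rw [ht, pow_mul, ho z hz.2, one_pow]
    · rw [Multiset.nodup_iff_count_le_one]
      intro z
      rw [Multiset.count_filter]
      split_ifs with hz
      · rw [count_roots]
        by_cases hr : q.IsRoot z
        · exact ((h z hr).2 hz).le
        · rw [rootMultiplicity_eq_zero hr]
          exact zero_le_one
      · exact zero_le_one

/-- Solutions of the recurrence given by a removable factor are asymptotically periodic. -/
theorem exists_periodic_of_isRemovableFactor {Q : ℤ[X]} (hQ : Q ≠ 0) (h : IsRemovableFactor Q)
    {q : ℕ → ℂ} (hq : act Q q =ᶠ[atTop] 0) :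
    ∃ (N : ℕ) (p : ℕ → ℂ), N ≠ 0 ∧ (∀ᶠ k in atTop, p (k + N) = p k) ∧
      Tendsto (q - p) atTop (nhds 0) := by
  obtain ⟨N, B, hN, hB, hroots, ⟨V, hV⟩⟩ := exists_dvd_of_isRemovableFactor hQ h
  have hkill : act ((X ^ N - 1) * B) q =ᶠ[atTop] 0 := by
    rw [hV, mul_comm, act_mul, act_map_intCast, ← act_zero (M := ℂ) V]
    exact act_eventuallyEq V hq
  have hcop : IsCoprime (X ^ N - 1 : ℂ[X]) B := by
    rw [isCoprime_iff_aeval_ne_zero_of_isAlgClosed (k := ℂ) ℂ]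
    intro z
    by_contra hz
    rw [not_or, not_not, not_not] at hz
    have h1 := hroots z (by simpa [IsRoot.def, coe_aeval_eq_eval] using hz.2)
    have h2 : z ^ N = 1 := by simpa [sub_eq_zero] using hz.1
    exact h1.ne ((pow_eq_one_iff_of_nonneg (norm_nonneg z) hN).1 (by rw [← norm_pow, h2, norm_one]))
  -- Bézout splits `q` into a part eventually killed by `X ^ N - 1`, hence periodic, and a part
  -- eventually killed by `B`, hence tending to zero.
  obtain ⟨u, v, huv⟩ := hcop
  refine ⟨N, act (v * B) q, hN, ?_, ?_⟩
  · have h1 : act (X ^ N - 1 : ℂ[X]) (act (v * B) q) =ᶠ[atTop] 0 := by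
      rw [← act_mul, show (X ^ N - 1) * (v * B) = v * ((X ^ N - 1) * B) by ring, act_mul,
        ← act_zero (M := ℂ) v]
      exact act_eventuallyEq v hkill
    filter_upwards [h1] with k hk
    rwa [act_X_pow_sub_one, Pi.zero_apply, sub_eq_zero] at hk
  · have h1 : q - act (v * B) q = act (u * (X ^ N - 1)) q := by
      rw [sub_eq_iff_eq_add, ← act_add_left, huv, act_one]
    rw [h1]
    refine tendsto_zero_of_act_eq_zero hB hroots ?_
    rw [← act_mul, show B * (u * (X ^ N - 1)) = u * ((X ^ N - 1) * B) by ring, act_mul,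
      ← act_zero (M := ℂ) u]
    exact act_eventuallyEq u hkill

theorem eq_mod_of_periodic {X : Type*} {p : ℕ → X} {K N : ℕ}
    (h : ∀ k, K ≤ k → p (k + N) = p k) {k : ℕ} (hk : K ≤ k) : p k = p (K + (k - K) % N) := by
  have h1 : Function.Periodic (fun j => p (K + j)) N := fun j => by
    simpa [add_assoc] using h (K + j) (by omega)
  have h2 := h1.map_mod_nat (k - K)
  rw [h2, Nat.add_sub_cancel' hk]

theorem isBigO_one_of_periodic {p : ℕ → ℂ} {N : ℕ} (hN : N ≠ 0)
    (h : ∀ᶠ k in atTop, p (k + N) = p k) : p =O[atTop] (fun _ => (1 : ℝ)) := by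
  obtain ⟨K, hK⟩ := eventually_atTop.1 h
  refine Asymptotics.IsBigO.of_bound (∑ i ∈ Finset.range N, ‖p (K + i)‖) ?_
  filter_upwards [eventually_ge_atTop K] with k hk
  rw [norm_one, mul_one, eq_mod_of_periodic hK hk]
  exact Finset.single_le_sum (f := fun i => ‖p (K + i)‖) (fun _ _ => norm_nonneg _)
    (Finset.mem_range.2 (Nat.mod_lt _ (Nat.pos_of_ne_zero hN)))

theorem finite_range_of_isBigO_one {w : ℕ → ℤ}
    (h : (fun k => (w k : ℝ)) =O[atTop] (fun _ => (1 : ℝ))) : (Set.range w).Finite := by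
  obtain ⟨c, hc⟩ := h.bound
  obtain ⟨K, hK⟩ := eventually_atTop.1 hc
  refine (((Set.finite_lt_nat K).image w).union (Set.finite_Icc (-⌈c⌉) ⌈c⌉)).subset ?_
  rintro _ ⟨k, rfl⟩
  rcases lt_or_ge k K with hk | hk
  · exact Or.inl ⟨k, hk, rfl⟩
  · right
    have h1 := hK k hk
    rw [norm_one, mul_one, Real.norm_eq_abs] at h1
    rw [Set.mem_Icc, ← abs_le]
    exact_mod_cast h1.trans (Int.le_ceil c)


/-! ### Limit values contained in short intervals. -/

theorem isRemovableFactor_one : IsRemovableFactor 1 := by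
  intro z hz
  simp [IsRoot.def] at hz

theorem exists_polyLength_lt {R : ℤ[X]} {c : ℝ} (h : overreducedLength R < c) :
    ∃ (P Q : ℤ[X]) (S : ℝ[X]), R = P * Q ∧ IsRemovableFactor Q ∧
      (S.leadingCoeff = 1 ∨ S.coeff 0 = 1) ∧
      polyLength (P.map (Int.castRingHom ℝ) * S) < c := by
  obtain ⟨_, ⟨P, Q, hPQ, hQ, rfl⟩, h1⟩ := exists_lt_of_csInf_lt
    (by exact ⟨_, R, 1, (mul_one R).symm, isRemovableFactor_one, rfl⟩) h
  obtain ⟨_, ⟨S, hS, rfl⟩, h2⟩ := exists_lt_of_csInf_lt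
    (by exact ⟨_, 1, Or.inl leadingCoeff_one, rfl⟩) h1
  exact ⟨P, Q, S, hPQ, hQ, hS, h2⟩

/-- Eventually the terms of a sequence stay, up to integers, close to the intervals that contain the
limit values along residue classes. -/
theorem eventually_exists_mem_Ioo {x : ℕ → ℝ} {M : ℕ} (hM : M ≠ 0) {a b : ℕ → ℝ} {η : ℝ}
    (hη : 0 < η)
    (h : ∀ l, limitValuesModOne (fun k => x (k * M + l)) ⊆ circleInterval (a l) (b l)) :
    ∀ᶠ k in atTop, ∃ m : ℤ, x k - m ∈ Set.Ioo (a (k % M) - η) (b (k % M) + η) := by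
  have h1 : ∀ l ∈ Finset.range M, ∀ᶠ j in atTop,
      ∃ m : ℤ, x (j * M + l) - m ∈ Set.Ioo (a l - η) (b l + η) := by
    intro l _
    have hU : IsOpen ((fun t : ℝ => (t : UnitAddCircle)) '' Set.Ioo (a l - η) (b l + η)) :=
      QuotientAddGroup.isOpenMap_coe _ isOpen_Ioo
    have hsub : circleInterval (a l) (b l) ⊆
        (fun t : ℝ => (t : UnitAddCircle)) '' Set.Ioo (a l - η) (b l + η) :=
      Set.image_mono (Set.Icc_subset_Ioo (by linarith) (by linarith))
    filter_upwards [eventually_mem_of_limitValues_subset hU ((h l).trans hsub)] with j hj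
    obtain ⟨t, ht, htx⟩ := hj
    have h2 : ((x (j * M + l) - t : ℝ) : UnitAddCircle) = 0 := by
      rw [AddCircle.coe_sub, sub_eq_zero]
      exact htx.symm
    obtain ⟨m, hm⟩ := (AddCircle.coe_eq_zero_iff 1).1 h2
    rw [zsmul_one] at hm
    exact ⟨m, by rwa [hm, sub_sub_cancel]⟩
  obtain ⟨J, hJ⟩ := eventually_atTop.1 ((Finset.range M).eventually_all.2 h1)
  filter_upwards [eventually_ge_atTop (J * M)] with k hk
  have h2 := hJ (k / M) ((Nat.le_div_iff_mul_le (Nat.pos_of_ne_zero hM)).2 hk) (k % M)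
    (Finset.mem_range.2 (Nat.mod_lt _ (Nat.pos_of_ne_zero hM)))
  rwa [Nat.div_add_mod'] at h2

theorem isBigO_one_of_mem_Ioo {t : ℕ → ℝ} {M : ℕ} (hM : M ≠ 0) {a b : ℕ → ℝ}
    (h : ∀ᶠ k in atTop, t k ∈ Set.Ioo (a (k % M)) (b (k % M))) :
    t =O[atTop] (fun _ => (1 : ℝ)) := by
  refine Asymptotics.IsBigO.of_bound (∑ l ∈ Finset.range M, (|a l| + |b l|)) ?_
  filter_upwards [h] with k hk
  rw [norm_one, mul_one, Real.norm_eq_abs]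
  refine le_trans ?_ (Finset.single_le_sum (f := fun l => |a l| + |b l|)
    (fun l _ => by positivity) (Finset.mem_range.2 (Nat.mod_lt k (Nat.pos_of_ne_zero hM))))
  rw [abs_le]
  have h1 := neg_abs_le (a (k % M))
  have h2 := le_abs_self (b (k % M))
  have h3 := abs_nonneg (a (k % M))
  have h4 := abs_nonneg (b (k % M))
  constructor <;> linarith [hk.1, hk.2]

/-- If the reduction of a recurrent sequence modulo one oscillates little along residue classes, then
the sequence is at bounded distance from a recurrent integer sequence. -/
theorem exists_recurrent_of_oscillation {P Q : ℤ[X]} (hP : P ≠ 0) (hQ : Q ≠ 0)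
    (hrem : IsRemovableFactor Q) {S : ℝ[X]} (hS : S.leadingCoeff = 1 ∨ S.coeff 0 = 1)
    {x : ℕ → ℝ} (hx : act (P * Q) x =ᶠ[atTop] 0) {Y : ℕ → ℤ} {M : ℕ} (hM : M ≠ 0) {c : ℝ}
    (hc : polyLength (P.map (Int.castRingHom ℝ) * S) * c < 1)
    (hb : (fun k => x k - Y k) =O[atTop] (fun _ => (1 : ℝ)))
    (hosc : ∃ K, ∀ k k', K ≤ k → K ≤ k' → k % M = k' % M →
      |(x k - Y k) - (x k' - Y k')| ≤ c) :
    ∃ P' : ℤ[X], P' ≠ 0 ∧ act P' Y =ᶠ[atTop] 0 := by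
  set t : ℕ → ℝ := fun k => x k - Y k with ht
  set PR := P.map (Int.castRingHom ℝ) with hPR
  have hwt : ∀ k, ((act P Y k : ℤ) : ℝ) = act P x k - act PR t k := by
    intro k
    have h1 : t = x - fun k => Int.castAddHom ℝ (Y k) := rfl
    rw [hPR, act_map_intCast, h1, act_sub, Pi.sub_apply, act_comp_addMonoidHom]
    simp
  let q : ℕ → ℂ := fun k => Complex.ofRealHom.toAddMonoidHom (act P x k)
  have hq : act Q q =ᶠ[atTop] 0 := by
    filter_upwards [hx] with k hk
    rw [act_comp_addMonoidHom, ← act_mul, mul_comm, hk]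
    simp
  obtain ⟨N, p, hN, hper, hqp⟩ := exists_periodic_of_isRemovableFactor hQ hrem hq
  have hPx : (act P x) =O[atTop] (fun _ => (1 : ℝ)) := by
    have h1 : q =O[atTop] (fun _ => (1 : ℝ)) := by
      have := (hqp.isBigO_one ℝ).add (isBigO_one_of_periodic hN hper)
      simpa using this
    refine (Asymptotics.isBigO_of_le _ fun k => ?_).trans h1
    exact (Complex.norm_real _).ge
  -- `act P Y` differs from the asymptotically periodic `act P x` by a bounded sequence, and bounded
  -- integers take finitely many values.
  have hfin : (Set.range (act P Y)).Finite := by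
    refine finite_range_of_isBigO_one ?_
    simp only [hwt]
    exact hPx.sub (isBigO_act PR hb)
  obtain ⟨K₁, hK₁⟩ := hosc
  obtain ⟨K₂, hK₂⟩ := eventually_atTop.1 hper
  -- the oscillation of `act P x` along residue classes tends to zero
  let ε := (1 - polyLength (PR * S) * c) / (2 * (polyLength S + 1))
  have hLS := polyLength_nonneg S
  have hε : 0 < ε := div_pos (by linarith) (by linarith)
  obtain ⟨K₃, hK₃⟩ := eventually_atTop.1 ((Metric.tendsto_nhds.1 hqp) (ε / 2) (by linarith))
  have hPosc : ∀ k k', K₂ + K₃ ≤ k → K₂ + K₃ ≤ k' → k % N = k' % N →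
      |act P x k - act P x k'| ≤ ε := by
    intro k k' hk hk' hkk
    have h1 : p k = p k' := by
      rw [eq_mod_of_periodic hK₂ (by omega : K₂ ≤ k), eq_mod_of_periodic hK₂ (by omega : K₂ ≤ k')]
      congr 2
      refine Nat.ModEq.add_left_cancel' K₂ ?_
      rwa [Nat.add_sub_cancel' (by omega), Nat.add_sub_cancel' (by omega)]
    have h2 : q k - q k' = (q - p) k - (q - p) k' := by
      simp only [Pi.sub_apply, h1]
      ring
    have h3 := hK₃ k (by omega)
    have h4 := hK₃ k' (by omega)
    rw [dist_zero_right] at h3 h4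
    have h5 : |act P x k - act P x k'| = ‖q k - q k'‖ := by
      have : q k - q k' = ((act P x k - act P x k' : ℝ) : ℂ) := by
        rw [Complex.ofReal_sub]; rfl
      rw [this, Complex.norm_real, Real.norm_eq_abs]
    rw [h5, h2]
    refine (norm_sub_le _ _).trans ?_
    linarith
  -- Congruence modulo `M * N` controls both `t` (modulo `M`) and `act P x` (modulo `N`).
  obtain ⟨N', hN', hper'⟩ := exists_period_of_oscillation hfin hS (M := M * N)
    (K := K₁ + K₂ + K₃) (mul_ne_zero hM hN) (by
      intro k k' hk hk' hkk
      have hmod : k ≡ k' [MOD M * N] := (ZMod.natCast_eq_natCast_iff _ _ _).1 hkk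
      have hmodM : ∀ i, (k + i) % M = (k' + i) % M := fun i =>
        (hmod.of_mul_right N).add_right i
      have hmodN : ∀ i, (k + i) % N = (k' + i) % N := fun i =>
        (hmod.of_mul_left M).add_right i
      have h1 : (fun k => ((act P Y k : ℤ) : ℝ)) = act P x - act PR t := funext hwt
      have h2 : act S (act PR t) = act (PR * S) t := by rw [mul_comm, act_mul]
      have h3 := abs_act_sub_act_le (A := S) (g := act P x) (k := k) (k' := k') (c := ε)
        fun i => hPosc _ _ (by omega) (by omega) (hmodN i)
      have h4 := abs_act_sub_act_le (A := PR * S) (g := t) (k := k) (k' := k') (c := c)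
        fun i => hK₁ _ _ (by omega) (by omega) (hmodM i)
      rw [h1, act_sub, h2, Pi.sub_apply, Pi.sub_apply, sub_sub_sub_comm]
      refine (abs_sub _ _).trans_lt ?_
      -- By the choice of `ε`, the contribution of `act P x` uses at most half of the slack left by
      -- that of `t`.
      have h5 : polyLength S * ε < 1 - polyLength (PR * S) * c := by
        have h6 : (polyLength S + 1) * ε = (1 - polyLength (PR * S) * c) / 2 := by
          simp only [ε]
          field_simp
        nlinarith
      linarith)
  refine ⟨(X ^ N' - 1) * P, mul_ne_zero ?_ hP, ?_⟩
  · simpa using X_pow_sub_C_ne_zero (Nat.pos_of_ne_zero hN') (1 : ℤ)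
  · filter_upwards [hper'] with k hk
    rw [act_mul, act_X_pow_sub_one, hk, sub_self]
    rfl

theorem exists_recurrent_of_intervals {R : ℤ[X]} (hR : R ≠ 0) {x : ℕ → ℝ}
    (hx : act R x =ᶠ[atTop] 0) {M : ℕ} (hM : M ≠ 0)
    (h : ∀ l : ℕ, ∃ a b : ℝ, b - a < 1 / overreducedLength R ∧
      limitValuesModOne (fun k => x (k * M + l)) ⊆ circleInterval a b) :
    ∃ (Y : ℕ → ℤ) (P : ℤ[X]), P ≠ 0 ∧ act P Y =ᶠ[atTop] 0 ∧
      (fun k => x k - Y k) =O[atTop] (fun _ => (1 : ℝ)) := by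
  choose a b hab hlim using h
  have hnonneg : ∀ l, 0 ≤ b l - a l := by
    intro l
    obtain ⟨z, hz⟩ := limitValuesModOne_nonempty (fun k => x (k * M + l))
    obtain ⟨s, hs, -⟩ := hlim l hz
    linarith [hs.1, hs.2]
  -- Only `M` residue classes occur, so one bound `c`, above the longest interval and below `1 /
  -- overreducedLength R`, serves all of them.
  obtain ⟨l₀, -, hl₀⟩ := Finset.exists_max_image (Finset.range M) (fun l => b l - a l)
    ⟨0, Finset.mem_range.2 (Nat.pos_of_ne_zero hM)⟩
  obtain ⟨c, hc1, hc2⟩ := exists_between (hab l₀)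
  have hc0 : 0 < c := (hnonneg l₀).trans_lt hc1
  have hlpos : 0 < overreducedLength R := one_div_pos.1 (hc0.trans hc2)
  obtain ⟨P, Q, S, rfl, hQ, hS, hPS⟩ := exists_polyLength_lt
    ((lt_one_div hc0 hlpos).1 hc2)
  have hη : 0 < (c - (b l₀ - a l₀)) / 2 := by linarith
  -- Enlarging the longest interval by `η` on each side gives length exactly `c`.
  set η := (c - (b l₀ - a l₀)) / 2 with hηdef
  have hev := eventually_exists_mem_Ioo hM hη hlim
  have hY : ∀ k, ∃ m : ℤ, (∃ m : ℤ, x k - m ∈ Set.Ioo (a (k % M) - η) (b (k % M) + η)) →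
      x k - m ∈ Set.Ioo (a (k % M) - η) (b (k % M) + η) := by
    intro k
    by_cases hk : ∃ m : ℤ, x k - m ∈ Set.Ioo (a (k % M) - η) (b (k % M) + η)
    · obtain ⟨m, hm⟩ := hk
      exact ⟨m, fun _ => hm⟩
    · exact ⟨0, fun h => absurd h hk⟩
  choose Y hY using hY
  have hmem : ∀ᶠ k in atTop, x k - Y k ∈ Set.Ioo (a (k % M) - η) (b (k % M) + η) :=
    hev.mono hY
  have hbd := isBigO_one_of_mem_Ioo (t := fun k => x k - Y k) (a := fun l => a l - η)
    (b := fun l => b l + η) hM hmem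
  obtain ⟨K, hK⟩ := eventually_atTop.1 hmem
  obtain ⟨P', hP', hP'Y⟩ := exists_recurrent_of_oscillation (left_ne_zero_of_mul hR)
    (right_ne_zero_of_mul hR) hQ hS hx hM ((lt_div_iff₀ hc0).1 hPS) hbd
    ⟨K, fun k k' hk hk' hkk => by
      have h1 := hK k hk
      have h2 := hK k' hk'
      rw [← hkk] at h2
      have h3 := hl₀ (k % M) (Finset.mem_range.2 (Nat.mod_lt _ (Nat.pos_of_ne_zero hM)))
      rw [abs_le]
      constructor <;> linarith [h1.1, h1.2, h2.1, h2.2]⟩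
  exact ⟨Y, P', hP', hP'Y, hbd⟩

end ModOne

/-! ### Assembly of the contrapositive arguments. -/

theorem theorem1p3
    (R : ℤ[X]) (hR : R ≠ 0)
    (x : ℕ → ℝ)
    (hrec : ∀ k : ℕ, 1 ≤ k →
      ∑ i ∈ Finset.range (R.natDegree + 1), (R.coeff i : ℝ) * x (k + i) = 0)
    (n : ℕ) (α : Fin n → ℂ) (hα : Function.Injective α) (F : Fin n → ℂ[X])
    (hx : ∀ k : ℕ, 1 ≤ k → (x k : ℂ) = ∑ i, (F i).eval (k : ℂ) * α i ^ k) :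
    (((∃ i, F i ≠ 0 ∧ 1 < ‖α i‖ ∧ ¬ IsIntegral ℤ (α i)) ∨
      (∃ i, 1 ≤ (F i).natDegree ∧ ‖α i‖ = 1 ∧ ¬ IsIntegral ℤ (α i)) ∨
      (∃ (i j : Fin n) (σ : ℂ ≃+* ℂ), 1 < ‖α i‖ ∧ 1 < ‖α j‖ ∧ σ (α i) = α j ∧
        (F i).map (σ : ℂ →+* ℂ) ≠ F j) ∨
      (∃ (i j : Fin n) (σ : ℂ ≃+* ℂ), 1 ≤ ‖α i‖ ∧ 1 ≤ ‖α j‖ ∧ σ (α i) = α j ∧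
        1 ≤ ((F i).map (σ : ℂ →+* ℂ) - F j).natDegree)) →
      (ModOne.limitValuesModOne x).Infinite ∧
      1 / ModOne.polyLength (R.map (Int.castRingHom ℝ)) ≤
        limsup (fun k : ℕ => ModOne.distNearestInt (x k)) atTop ∧
      ∀ M : ℕ, 1 ≤ M → ∃ l : ℕ, ∀ a b : ℝ, b - a < 1 / ModOne.overreducedLength R →
        ¬ ModOne.limitValuesModOne (fun k : ℕ => x (k * M + l)) ⊆ ModOne.circleInterval a b) ∧
    ((∃ (i j : Fin n) (σ : ℂ ≃+* ℂ), 1 < ‖α i‖ ∧ 1 ≤ ‖α j‖ ∧ σ (α i) = α j ∧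
        (F i).map (σ : ℂ →+* ℂ) ≠ F j) →
      (ModOne.limitValuesModOne x).Infinite) := by
  have hx' : ∀ᶠ k : ℕ in atTop, (x k : ℂ) = ∑ i, (F i).eval (k : ℂ) * α i ^ k :=
    eventually_atTop.2 ⟨1, hx⟩
  have hrec' : ModOne.act R x =ᶠ[atTop] 0 := by
    filter_upwards [eventually_ge_atTop 1] with k hk
    rw [ModOne.act_apply_range, Pi.zero_apply, ← hrec k hk]
    simp only [zsmul_eq_mul]
  refine ⟨fun hwild => ⟨fun hfin => ?_, ?_, fun M hM => ?_⟩, ?_⟩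
  · obtain ⟨D, Y, hD, hY, hb, -⟩ := ModOne.exists_recurrent_of_finite hR hrec' hfin
    exact ModOne.not_isWild_of_bounded hα hx' hD hR hY hb hwild
  · by_contra hlt
    obtain ⟨Y, hY, hb⟩ := ModOne.exists_recurrent_of_limsup_lt hrec' (not_le.1 hlt)
    exact ModOne.not_isWild_of_bounded hα hx' one_ne_zero hR hY (by simpa using hb) hwild
  · by_contra hne
    push Not at hne
    obtain ⟨Y, P, hP, hY, hb⟩ := ModOne.exists_recurrent_of_intervals hR hrec' (by omega) hne
    exact ModOne.not_isWild_of_bounded hα hx' one_ne_zero hP hY (by simpa using hb) hwild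
  · rintro ⟨i, j, σ, hi, hj, hij, hF⟩ hfin
    obtain ⟨D, Y, hD, hY, hb, N, hN, hper⟩ := ModOne.exists_recurrent_of_finite hR hrec' hfin
    exact hF (ModOne.map_eq_of_bounded_of_periodic hα hx' hD hR hY hb hN hper hi hj hij)
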